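/- Let $n\ge 0$ be an integer, let $B_1\subset\mathbb R^n$ be the open unit ball centred at the origin, and put $c=\cos\frac{\pi}{4}$, $s=\sin\frac{\pi}{4}$. Let $\psi=\psi(x,r,p)$ be a continuous real-valued function on $B_1\times\mathbb R\times\mathbb R^n$, and let $u:B_1\to\mathbb R$ be a convex viscosity solution on $B_1$ of $$\sum_{i=1}^n\arctan\lambda_i(D^2u)=\psi(x,u,Du),$$ where $\lambda_i$ are the eigenvalues of the Hessian. (A function $v$ is a viscosity solution of $\sum_i\arctan\lambda_i(D^2v)=f(x,v,Dv)$ on $\Omega$ if it is continuous on $\Omega$ and, whenever $\varphi$ is $C^2$ near $x_0\in\Omega$ and $v-\varphi$ has a local maximum [resp. minimum] over $\Omega$ at $x_0$, one has $\sum_i\arctan\lambda_i(D^2\varphi(x_0))\ge f(x_0,v(x_0),D\varphi(x_0))$ [resp. $\le$].) Define $$\tilde u(x)=s\,u(x)+\tfrac c2|x|^2\quad(x\in B_1),\qquad \tilde u^*(\bar x)=\sup_{x\in B_1}\bigl[x\cdot\bar x-\tilde u(x)\bigr],\qquad \bar u(\bar x)=\frac{c}{2s}|\bar x|^2-\frac1s\,\tilde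 u^*(\bar x),$$ and let $\bar\Omega=\partial\tilde u(B_1)=\bigcup_{x\in B_1}\partial\tilde u(x)$, where $\partial\tilde u(x)=\{y:\ \tilde u(z)\ge\tilde u(x)+y\cdot(z-x)\ \text{for all } z\in B_1\}$ is the subdifferential. Suppose that either $u\in C^1(B_1)$, or $p\mapsto\psi(x,r,p)$ is convex on $\mathbb R^n$ for each fixed $(x,r)\in B_1\times\mathbb R$. Then $\bar\Omega$ is open, $\bar u$ is differentiable on $\bar\Omega$ with $x(\bar x):=c\bar x-sD\bar u(\bar x)\in B_1$ for every $\bar x\in\bar\Omega$, and $\bar u$ is a viscosity solution on $\bar\Omega$ of the rotated equation $$\sum_{i=1}^n\arctan\lambda_i(D^2\bar u(\bar x))=\psi\bigl(x(\bar x),\,u(x(\bar x)),\,s\bar x+cD\bar u(\bar x)\bigr)-\frac{n\pi}{4}.$$ -/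

import Mathlib

open Set Metric

open scoped RealInnerProductSpace

noncomputable section

/-- The Hessian matrix `D²φ(x)`, with entries `∂ᵢ∂ⱼφ(x)` in the standard basis. -/
def hessian {n : ℕ} (φ : EuclideanSpace ℝ (Fin n) → ℝ) (x : EuclideanSpace ℝ (Fin n)) :
    Matrix (Fin n) (Fin n) ℝ :=
  Matrix.of fun i j =>
    fderiv ℝ (fderiv ℝ φ) x (EuclideanSpace.single i 1) (EuclideanSpace.single j 1)

/-- The Lagrangian phase `θ(A) = ∑ arctan λᵢ` of a real symmetric matrix `A`, where the `λᵢ` are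
the eigenvalues of `A` repeated with multiplicity, i.e. the roots of its characteristic
polynomial. -/
def phase {n : ℕ} (A : Matrix (Fin n) (Fin n) ℝ) : ℝ :=
  (A.charpoly.roots.map Real.arctan).sum

/-- `phase` is the sum of the arctangents of the eigenvalues. -/
theorem phase_eq_sum_eigenvalues {n : ℕ} {A : Matrix (Fin n) (Fin n) ℝ} (hA : A.IsHermitian) :
    phase A = ∑ i, Real.arctan (hA.eigenvalues i) := by
  have h := hA.roots_charpoly_eq_eigenvalues
  simp only [phase, h, Multiset.map_map]
  rfl

/-- `u` is a viscosity solution of `∑ arctan λᵢ(D²u) = f(x, u, Du)` on `Ω`: it is continuous, and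
the equation holds as the inequality `≥` (resp. `≤`) for every `C²` test function touching `u`
from above (resp. below) at a point of `Ω`, the gradient being that of the test function. -/
structure IsViscositySolution {n : ℕ} (Ω : Set (EuclideanSpace ℝ (Fin n)))
    (f : EuclideanSpace ℝ (Fin n) → ℝ → EuclideanSpace ℝ (Fin n) → ℝ)
    (u : EuclideanSpace ℝ (Fin n) → ℝ) : Prop where
  continuousOn : ContinuousOn u Ω
  subsolution : ∀ x ∈ Ω, ∀ φ : EuclideanSpace ℝ (Fin n) → ℝ, ContDiffAt ℝ 2 φ x →
    IsLocalMaxOn (fun y => u y - φ y) Ω x → f x (u x) (gradient φ x) ≤ phase (hessian φ x)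
  supersolution : ∀ x ∈ Ω, ∀ φ : EuclideanSpace ℝ (Fin n) → ℝ, ContDiffAt ℝ 2 φ x →
    IsLocalMinOn (fun y => u y - φ y) Ω x → phase (hessian φ x) ≤ f x (u x) (gradient φ x)

/-- The subdifferential at `x` of a function `f` with domain `Ω`: the slopes of the affine
functions that touch `f` from below at `x`. -/
def subdifferential {n : ℕ} (Ω : Set (EuclideanSpace ℝ (Fin n)))
    (f : EuclideanSpace ℝ (Fin n) → ℝ) (x : EuclideanSpace ℝ (Fin n)) :
    Set (EuclideanSpace ℝ (Fin n)) :=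
  {y | ∀ z ∈ Ω, f x + ⟪y, z - x⟫ ≤ f z}

/-- The Legendre transform `f*(y) = sup_{x ∈ Ω} (x · y - f x)` of a function with domain `Ω`. -/
def legendre {n : ℕ} (Ω : Set (EuclideanSpace ℝ (Fin n)))
    (f : EuclideanSpace ℝ (Fin n) → ℝ) (y : EuclideanSpace ℝ (Fin n)) : ℝ :=
  sSup ((fun x => ⟪x, y⟫ - f x) '' Ω)

/-- The supremum in `legendre` is attained, hence finite, at every subgradient of `f`. -/
theorem isGreatest_legendre {n : ℕ} {Ω : Set (EuclideanSpace ℝ (Fin n))}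
    {f : EuclideanSpace ℝ (Fin n) → ℝ} {x y : EuclideanSpace ℝ (Fin n)} (hx : x ∈ Ω)
    (hy : y ∈ subdifferential Ω f x) :
    IsGreatest ((fun x => ⟪x, y⟫ - f x) '' Ω) (legendre Ω f y) := by
  have h : IsGreatest ((fun x => ⟪x, y⟫ - f x) '' Ω) (⟪x, y⟫ - f x) := by
    refine ⟨⟨x, hx, rfl⟩, ?_⟩
    rintro _ ⟨z, hz, rfl⟩
    have h1 := hy z hz
    rw [inner_sub_right, real_inner_comm z y, real_inner_comm x y] at h1
    show ⟪z, y⟫ - f z ≤ ⟪x, y⟫ - f x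
    linarith
  have e : legendre Ω f y = ⟪x, y⟫ - f x := h.csSup_eq
  rw [e]
  exact h

/-- The auxiliary function `ũ(x) = s u(x) + (c/2)|x|²`, with `c = cos (π/4)`, `s = sin (π/4)`. -/
def auxPotential {n : ℕ} (u : EuclideanSpace ℝ (Fin n) → ℝ) (x : EuclideanSpace ℝ (Fin n)) : ℝ :=
  Real.sin (Real.pi / 4) * u x + Real.cos (Real.pi / 4) / 2 * ‖x‖ ^ 2

/-- The rotated domain `∂ũ(Ω) = ⋃_{x ∈ Ω} ∂ũ(x)`. -/
def rotatedDomain {n : ℕ} (Ω : Set (EuclideanSpace ℝ (Fin n)))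
    (u : EuclideanSpace ℝ (Fin n) → ℝ) : Set (EuclideanSpace ℝ (Fin n)) :=
  ⋃ x ∈ Ω, subdifferential Ω (auxPotential u) x

/-- The rotated potential `ū(x̄) = (c/(2s))|x̄|² - (1/s) ũ*(x̄)` of a function `u` with
domain `Ω`. -/
def rotatedPotential {n : ℕ} (Ω : Set (EuclideanSpace ℝ (Fin n)))
    (u : EuclideanSpace ℝ (Fin n) → ℝ) (y : EuclideanSpace ℝ (Fin n)) : ℝ :=
  Real.cos (Real.pi / 4) / (2 * Real.sin (Real.pi / 4)) * ‖y‖ ^ 2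
    - 1 / Real.sin (Real.pi / 4) * legendre Ω (auxPotential u) y

/-- The point `c x̄ - s p`. For `p = Dū(x̄)` it is the base point `x(x̄)` of the original graph
that is rotated to the point of the new graph over `x̄`. -/
def basePoint {n : ℕ} (y p : EuclideanSpace ℝ (Fin n)) : EuclideanSpace ℝ (Fin n) :=
  Real.cos (Real.pi / 4) • y - Real.sin (Real.pi / 4) • p

/-- The right-hand side of the rotated equation,
`(x̄, p) ↦ ψ(x, u(x), s x̄ + c p) - nπ/4` with `x = c x̄ - s p`; it does not depend on the value
of the unknown. -/
def rotatedPhase {n : ℕ}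
    (ψ : EuclideanSpace ℝ (Fin n) → ℝ → EuclideanSpace ℝ (Fin n) → ℝ)
    (u : EuclideanSpace ℝ (Fin n) → ℝ)
    (y : EuclideanSpace ℝ (Fin n)) (_r : ℝ) (p : EuclideanSpace ℝ (Fin n)) : ℝ :=
  ψ (basePoint y p) (u (basePoint y p))
      (Real.sin (Real.pi / 4) • y + Real.cos (Real.pi / 4) • p)
    - n * Real.pi / 4

end

/-!
Write `c = cos (π / 4)` and `s = sin (π / 4)`. Rotating the gradient graph of `u` by `π / 4` moves
the point over `x` to `x̄ = c x + s Du(x)`, which is the gradient of `ũ = s u + (c / 2) |x|²`; since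
`ũ` is strongly convex, its Legendre transform is `C¹` on the open set of subgradients of `ũ`.
Passing to the transform inverts Hessians, so `D²ū = s⁻¹ (c - (s D²u + c)⁻¹)` and each Hessian
angle drops by exactly `π / 4`.

That `ū` is a supersolution follows by duality alone: a paraboloid touching `ū` from below becomes
one touching `ũ*` from above, and its dual touches `ũ` from below. Dualizing a paraboloid that
touches from the other side would require regularity of `u`, so the subsolution property goes
through approximation. By Alexandrov's theorem the convex function `u` satisfies the equation
almost everywhere, with `ψ` bounded below near a point by an affine function of `Du`. As the phase
is concave on nonnegative forms and the absolutely continuous part of the second derivative of a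
convex function is dominated by the full one, mollifications of `u` satisfy the same differential
inequality classically. For them the duality is elementary, and the inequality survives the limit
because strict touching from below of the Legendre transforms is stable under uniform convergence.
-/

noncomputable section

open Filter Topology MeasureTheory

section Forms

variable {E : Type*} [NormedAddCommGroup E] [InnerProductSpace ℝ E]

/-- Symmetry of a continuous bilinear form. -/
def IsSymmForm (b : E →L[ℝ] E →L[ℝ] ℝ) : Prop :=
  ∀ h k, b h k = b k h

theorem IsSymmForm.add {a b : E →L[ℝ] E →L[ℝ] ℝ} (ha : IsSymmForm a) (hb : IsSymmForm b) :
    IsSymmForm (a + b) := fun h k => congrArg₂ (· + ·) (ha h k) (hb h k)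

theorem IsSymmForm.smul {b : E →L[ℝ] E →L[ℝ] ℝ} (hb : IsSymmForm b) (t : ℝ) :
    IsSymmForm (t • b) := fun h k => congrArg (t * ·) (hb h k)

theorem IsSymmForm.sub {a b : E →L[ℝ] E →L[ℝ] ℝ} (ha : IsSymmForm a) (hb : IsSymmForm b) :
    IsSymmForm (a - b) := fun h k => congrArg₂ (· - ·) (ha h k) (hb h k)

variable (E) in
/-- The inner product as a bilinear form; it plays the role of the identity matrix. -/
def innerForm : E →L[ℝ] E →L[ℝ] ℝ := innerSL ℝ

@[simp]
theorem innerForm_apply (h k : E) : innerForm E h k = ⟪h, k⟫ := rfl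

theorem innerForm_self (h : E) : innerForm E h h = ‖h‖ ^ 2 := real_inner_self_eq_norm_sq h

theorem isSymmForm_innerForm : IsSymmForm (innerForm E) := fun h k => real_inner_comm k h

variable {ι : Type*} [Fintype ι]

/-- The symmetric bilinear form with eigenbasis `e` and eigenvalues `d`. -/
def diagForm (e : OrthonormalBasis ι ℝ E) (d : ι → ℝ) : E →L[ℝ] E →L[ℝ] ℝ :=
  ∑ i, d i • (innerSL ℝ (e i)).smulRight (innerSL ℝ (e i))

theorem diagForm_apply (e : OrthonormalBasis ι ℝ E) (d : ι → ℝ) (h k : E) :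
    diagForm e d h k = ∑ i, d i * (⟪e i, h⟫ * ⟪e i, k⟫) := by
  simp [diagForm]

theorem diagForm_self (e : OrthonormalBasis ι ℝ E) (d : ι → ℝ) (h : E) :
    diagForm e d h h = ∑ i, d i * ⟪e i, h⟫ ^ 2 := by
  simp only [diagForm_apply, sq]

theorem diagForm_basis (e : OrthonormalBasis ι ℝ E) (d : ι → ℝ) (i : ι) :
    diagForm e d (e i) (e i) = d i := by
  classical simp [diagForm_self, e.inner_eq_ite]

theorem isSymmForm_diagForm (e : OrthonormalBasis ι ℝ E) (d : ι → ℝ) :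
    IsSymmForm (diagForm e d) := fun h k => by
  simp only [diagForm_apply, mul_comm ⟪e _, h⟫]

theorem diagForm_smul (e : OrthonormalBasis ι ℝ E) (t : ℝ) (d : ι → ℝ) :
    diagForm e (t • d) = t • diagForm e d := by
  ext h k
  simp [diagForm_apply, Finset.mul_sum, mul_assoc]

theorem diagForm_sub (e : OrthonormalBasis ι ℝ E) (d d' : ι → ℝ) :
    diagForm e (d - d') = diagForm e d - diagForm e d' := by
  ext h k
  simp [diagForm_apply, sub_mul, Finset.sum_sub_distrib]

theorem diagForm_add (e : OrthonormalBasis ι ℝ E) (d d' : ι → ℝ) :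
    diagForm e (d + d') = diagForm e d + diagForm e d' := by
  ext h k
  simp [diagForm_apply, add_mul, Finset.sum_add_distrib]

theorem diagForm_one (e : OrthonormalBasis ι ℝ E) : diagForm e 1 = innerForm E := by
  ext h k
  simp [diagForm_apply, ← e.sum_inner_mul_inner h k, real_inner_comm]

theorem inner_eq_zero_of_mem_span_image (e : OrthonormalBasis ι ℝ E) {I : Set ι} {x : E}
    (hx : x ∈ Submodule.span ℝ (e '' I)) {i : ι} (hi : i ∉ I) : ⟪e i, x⟫ = 0 := by
  rw [← e.coe_toBasis, e.toBasis.mem_span_image] at hx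
  by_contra hne
  exact hi (hx (by simpa [e.repr_apply_apply] using hne))

theorem mul_norm_sq_le_diagForm (e : OrthonormalBasis ι ℝ E) {d : ι → ℝ} {I : Set ι} {t : ℝ}
    (hI : ∀ i ∈ I, t ≤ d i) {x : E} (hx : x ∈ Submodule.span ℝ (e '' I)) :
    t * ‖x‖ ^ 2 ≤ diagForm e d x x := by
  rw [diagForm_self, ← e.sum_sq_inner_right, Finset.mul_sum]
  refine Finset.sum_le_sum fun i _ => ?_
  by_cases hi : i ∈ I
  · exact mul_le_mul_of_nonneg_right (hI i hi) (sq_nonneg _)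
  · simp [inner_eq_zero_of_mem_span_image e hx hi]

theorem diagForm_lt_mul_norm_sq (e : OrthonormalBasis ι ℝ E) {d : ι → ℝ} {I : Set ι} {t : ℝ}
    (hI : ∀ i ∈ I, d i < t) {x : E} (hx : x ∈ Submodule.span ℝ (e '' I)) (hne : x ≠ 0) :
    diagForm e d x x < t * ‖x‖ ^ 2 := by
  have hzero {i : ι} (hi : i ∉ I) : ⟪e i, x⟫ = 0 := inner_eq_zero_of_mem_span_image e hx hi
  obtain ⟨j, hj⟩ : ∃ j, ⟪e j, x⟫ ≠ 0 := by
    by_contra! h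
    exact hne (by rw [← e.sum_repr' x]; simp [h])
  rw [diagForm_self, ← e.sum_sq_inner_right, Finset.mul_sum]
  refine Finset.sum_lt_sum (fun i _ => ?_) ⟨j, Finset.mem_univ j, ?_⟩
  · by_cases hi : i ∈ I
    · exact mul_le_mul_of_nonneg_right (hI i hi).le (sq_nonneg _)
    · simp [hzero hi]
  · exact mul_lt_mul_of_pos_right (hI j (not_imp_comm.mp hzero hj)) (by positivity)

theorem finrank_span_image_orthonormalBasis (e : OrthonormalBasis ι ℝ E) (I : Finset ι) :
    Module.finrank ℝ (Submodule.span ℝ (e '' I)) = I.card := by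
  rw [image_eq_range, ← Fintype.card_coe I]
  exact finrank_span_eq_card
    (e.orthonormal.linearIndependent.comp ((↑) : I → ι) Subtype.val_injective)

-- The eigenspaces of `d` above level `t` and of `d'` below it meet only at `0`.
theorem card_filter_le_of_diagForm_le {e e' : OrthonormalBasis ι ℝ E} {d d' : ι → ℝ}
    (h : ∀ x, diagForm e d x x ≤ diagForm e' d' x x) (t : ℝ) :
    (Finset.univ.filter fun i => t ≤ d i).card ≤ (Finset.univ.filter fun i => t ≤ d' i).card := by
  classical
  set I := Finset.univ.filter fun i => t ≤ d i
  set J := Finset.univ.filter fun i => t ≤ d' i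
  have hdisj : Disjoint (Submodule.span ℝ (e '' I)) (Submodule.span ℝ (e' '' (Jᶜ : Finset ι))) := by
    refine Submodule.disjoint_def.mpr fun x hx hx' => by_contra fun hne => ?_
    have hlow := mul_norm_sq_le_diagForm e (d := d) (t := t) (by simp [I]) hx
    have hhigh := diagForm_lt_mul_norm_sq e' (d := d') (t := t) (by simp [J]) hx' hne
    exact (hlow.trans (h x)).not_gt hhigh
  have : FiniteDimensional ℝ E := e.toBasis.finiteDimensional_of_finite
  have hdim := Submodule.finrank_add_finrank_le_of_disjoint hdisj
  rw [finrank_span_image_orthonormalBasis, finrank_span_image_orthonormalBasis,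
    Module.finrank_eq_card_basis e.toBasis, ← J.card_add_card_compl] at hdim
  lia

end Forms

section Phase

variable {n : ℕ}

local notation "𝔼" => EuclideanSpace ℝ (Fin n)

/-- The phase of a bilinear form on Euclidean space, that is, of its matrix in the standard
basis. -/
def formPhase (b : 𝔼 →L[ℝ] 𝔼 →L[ℝ] ℝ) : ℝ :=
  phase (Matrix.of fun i j => b (EuclideanSpace.single i 1) (EuclideanSpace.single j 1))

theorem phase_conj_diagonal {P : Matrix (Fin n) (Fin n) ℝ} (hP : P.transpose * P = 1)
    (d : Fin n → ℝ) :
    phase (P * (Matrix.diagonal d * P.transpose)) = ∑ i, Real.arctan (d i) := by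
  have hroots : (∏ i, (Polynomial.X - Polynomial.C (d i))).roots = Finset.univ.val.map d := by
    simpa [Finset.prod, Multiset.map_map, Function.comp_def] using
      Polynomial.roots_multiset_prod_X_sub_C (Finset.univ.val.map d)
  rw [phase, Matrix.charpoly_mul_comm, Matrix.mul_assoc, hP, Matrix.mul_one,
    Matrix.charpoly_diagonal, hroots, Multiset.map_map]
  rfl

theorem formPhase_diagForm (e : OrthonormalBasis (Fin n) ℝ 𝔼) (d : Fin n → ℝ) :
    formPhase (diagForm e d) = ∑ i, Real.arctan (d i) := by
  set P : Matrix (Fin n) (Fin n) ℝ := Matrix.of fun i k => e k i with hP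
  have hPP : P.transpose * P = 1 := by
    ext i j
    simpa [PiLp.inner_apply, Matrix.mul_apply, hP, Matrix.one_apply, mul_comm] using
      orthonormal_iff_ite.mp e.orthonormal i j
  rw [← phase_conj_diagonal hPP d, formPhase]
  congr 1
  ext i j
  rw [Matrix.of_apply, diagForm_apply, Matrix.mul_apply]
  refine Finset.sum_congr rfl fun k _ => ?_
  simp only [EuclideanSpace.inner_single_right, Matrix.diagonal_mul, Matrix.of_apply,
    Matrix.transpose_apply, conj_trivial, one_mul, hP]
  ring

theorem clm_bilin_ext_single {b b' : 𝔼 →L[ℝ] 𝔼 →L[ℝ] ℝ}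
    (h : ∀ i j, b (EuclideanSpace.single i 1) (EuclideanSpace.single j 1) =
      b' (EuclideanSpace.single i 1) (EuclideanSpace.single j 1)) : b = b' := by
  have hlin : b.toLinearMap₁₂ = b'.toLinearMap₁₂ := by
    apply LinearMap.ext_basis (EuclideanSpace.basisFun (Fin n) ℝ).toBasis
      (EuclideanSpace.basisFun (Fin n) ℝ).toBasis
    simpa using h
  ext x y
  exact congrArg (fun f => f x y) hlin

theorem IsSymmForm.exists_eq_diagForm {b : 𝔼 →L[ℝ] 𝔼 →L[ℝ] ℝ} (hb : IsSymmForm b) :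
    ∃ (e : OrthonormalBasis (Fin n) ℝ 𝔼) (d : Fin n → ℝ), b = diagForm e d := by
  set A : Matrix (Fin n) (Fin n) ℝ :=
    Matrix.of fun i j => b (EuclideanSpace.single i 1) (EuclideanSpace.single j 1) with hA
  have hH : A.IsHermitian := by
    ext i j
    simp [hA, hb (EuclideanSpace.single j 1)]
  refine ⟨hH.eigenvectorBasis, hH.eigenvalues, clm_bilin_ext_single fun i j => ?_⟩
  refine (congrFun (congrFun hH.spectral_theorem i) j).trans ?_
  rw [Unitary.conjStarAlgAut_apply, Matrix.mul_apply, diagForm_apply]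
  refine Finset.sum_congr rfl fun k _ => ?_
  simp only [Function.comp_def, Matrix.mul_diagonal, Matrix.star_apply, RCLike.ofReal_real_eq_id,
    Matrix.IsHermitian.eigenvectorUnitary_apply, EuclideanSpace.inner_single_right, id_eq,
    conj_trivial, star_trivial, one_mul]
  ring

theorem formPhase_mono {a b : 𝔼 →L[ℝ] 𝔼 →L[ℝ] ℝ} (ha : IsSymmForm a) (hb : IsSymmForm b)
    (hle : ∀ x, a x x ≤ b x x) : formPhase a ≤ formPhase b := by
  obtain ⟨e, d, rfl⟩ := ha.exists_eq_diagForm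
  obtain ⟨e', d', rfl⟩ := hb.exists_eq_diagForm
  -- Hall's marriage theorem pairs each eigenvalue of `a` with a larger eigenvalue of `b`.
  have hall : ∀ I : Finset (Fin n),
      I.card ≤ (I.biUnion fun i => Finset.univ.filter fun j => d i ≤ d' j).card := by
    intro I
    rcases I.eq_empty_or_nonempty with rfl | hI
    · simp
    obtain ⟨i₀, hi₀, hmin⟩ := I.exists_min_image d hI
    calc I.card ≤ (Finset.univ.filter fun i => d i₀ ≤ d i).card :=
          Finset.card_le_card fun i hi => by simpa using hmin i hi
      _ ≤ (Finset.univ.filter fun i => d i₀ ≤ d' i).card := card_filter_le_of_diagForm_le hle _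
      _ ≤ _ := Finset.card_le_card (Finset.subset_biUnion_of_mem
          (fun i => Finset.univ.filter fun j => d i ≤ d' j) hi₀)
  obtain ⟨σ, hσ, hmem⟩ := (Finset.all_card_le_biUnion_card_iff_exists_injective _).mp hall
  rw [formPhase_diagForm, formPhase_diagForm,
    ← Equiv.sum_comp (Equiv.ofBijective σ (Finite.injective_iff_bijective.mp hσ))
      (fun j => Real.arctan (d' j))]
  refine Finset.sum_le_sum fun i _ => Real.arctan_strictMono.monotone ?_
  simpa using hmem i

theorem arctan_add_le {a t : ℝ} (ht : 0 ≤ t) : Real.arctan (a + t) ≤ Real.arctan a + t := by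
  have hderiv (x : ℝ) :
      HasDerivAt (fun x => x - Real.arctan x) (1 - (1 + x ^ 2)⁻¹) x :=
    (hasDerivAt_id x).sub (Real.hasDerivAt_arctan' x)
  have hmono : Monotone fun x => x - Real.arctan x :=
    monotone_of_hasDerivAt_nonneg hderiv fun x =>
      sub_nonneg.mpr (inv_le_one_of_one_le₀ (by nlinarith [sq_nonneg x]))
  have := hmono (le_add_of_nonneg_right ht : a ≤ a + t)
  simp only at this
  linarith

theorem formPhase_add_smul_innerForm_le {b : 𝔼 →L[ℝ] 𝔼 →L[ℝ] ℝ} (hb : IsSymmForm b) {t : ℝ}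
    (ht : 0 ≤ t) : formPhase (b + t • innerForm 𝔼) ≤ formPhase b + n * t := by
  obtain ⟨e, d, rfl⟩ := hb.exists_eq_diagForm
  rw [← diagForm_one e, ← diagForm_smul, ← diagForm_add, formPhase_diagForm, formPhase_diagForm]
  calc ∑ i, Real.arctan ((d + t • 1) i) ≤ ∑ i, (Real.arctan (d i) + t) :=
        Finset.sum_le_sum fun i _ => by simpa using arctan_add_le ht
    _ = _ := by simp [Finset.sum_add_distrib]

theorem formPhase_le_of_eventually_sub {b : 𝔼 →L[ℝ] 𝔼 →L[ℝ] ℝ} (hb : IsSymmForm b) {C : ℝ}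
    (h : ∀ᶠ ε in 𝓝[>] (0 : ℝ), formPhase (b - ε • innerForm 𝔼) ≤ C) : formPhase b ≤ C := by
  have hlim : Tendsto (fun ε : ℝ => C + n * ε) (𝓝[>] 0) (𝓝 C) :=
    tendsto_nhdsWithin_of_tendsto_nhds (by simpa using (by fun_prop :
      Continuous fun ε : ℝ => C + n * ε).tendsto 0)
  refine ge_of_tendsto hlim ?_
  filter_upwards [h, self_mem_nhdsWithin] with ε hε hpos
  have := formPhase_add_smul_innerForm_le (hb.sub (isSymmForm_innerForm.smul ε)) (le_of_lt hpos)
  have hcancel : b - ε • innerForm 𝔼 + ε • innerForm 𝔼 = b := by ext; simp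
  rw [hcancel] at this
  linarith

theorem le_formPhase_of_eventually_add {b : 𝔼 →L[ℝ] 𝔼 →L[ℝ] ℝ} (hb : IsSymmForm b) {C : ℝ}
    (h : ∀ᶠ ε in 𝓝[>] (0 : ℝ), C ≤ formPhase (b + ε • innerForm 𝔼)) : C ≤ formPhase b := by
  have hlim : Tendsto (fun ε : ℝ => C - n * ε) (𝓝[>] 0) (𝓝 C) :=
    tendsto_nhdsWithin_of_tendsto_nhds (by simpa using (by fun_prop :
      Continuous fun ε : ℝ => C - n * ε).tendsto 0)
  refine le_of_tendsto hlim ?_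
  filter_upwards [h, self_mem_nhdsWithin] with ε hε hpos
  have := formPhase_add_smul_innerForm_le hb (le_of_lt hpos)
  linarith

theorem concaveOn_arctan : ConcaveOn ℝ (Ici 0) Real.arctan := by
  refine AntitoneOn.concaveOn_of_deriv (convex_Ici 0) Real.continuous_arctan.continuousOn
    Real.differentiable_arctan.differentiableOn fun x hx y _ hxy => ?_
  have hx : 0 < x := by simpa using hx
  simp only [Real.deriv_arctan]
  gcongr

theorem arctan_le_tangent {a μ : ℝ} (ha : 0 ≤ a) (hμ : 0 ≤ μ) :
    Real.arctan a ≤ Real.arctan μ + (1 + μ ^ 2)⁻¹ * (a - μ) := by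
  have hderiv := Real.hasDerivAt_arctan' μ
  rcases lt_trichotomy a μ with h | rfl | h
  · have := concaveOn_arctan.le_slope_of_hasDerivAt ha hμ h hderiv
    rw [slope_def_field, le_div_iff₀ (by linarith)] at this
    linarith
  · simp
  · have := concaveOn_arctan.slope_le_of_hasDerivAt hμ ha h hderiv
    rw [slope_def_field, div_le_iff₀ (by linarith)] at this
    linarith

-- The phase is concave on nonnegative forms; `diagForm v μ` is the point of linearization.
theorem formPhase_le_linearization {b : 𝔼 →L[ℝ] 𝔼 →L[ℝ] ℝ} (hb : IsSymmForm b)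
    (hpos : ∀ x, 0 ≤ b x x) (v : OrthonormalBasis (Fin n) ℝ 𝔼) {μ : Fin n → ℝ}
    (hμ : ∀ j, 0 ≤ μ j) :
    formPhase b ≤ ∑ j, (Real.arctan (μ j) + (1 + μ j ^ 2)⁻¹ * (b (v j) (v j) - μ j)) := by
  obtain ⟨e, d, rfl⟩ := hb.exists_eq_diagForm
  have hd : ∀ i, 0 ≤ d i := fun i => diagForm_basis e d i ▸ hpos (e i)
  have hrow (i : Fin n) : ∑ j, ⟪e i, v j⟫ ^ 2 = 1 := by simp [v.sum_sq_inner_left]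
  have hcol (j : Fin n) : ∑ i, ⟪e i, v j⟫ ^ 2 = 1 := by simp [e.sum_sq_inner_right]
  rw [formPhase_diagForm]
  calc ∑ i, Real.arctan (d i)
      = ∑ i, ∑ j, ⟪e i, v j⟫ ^ 2 * Real.arctan (d i) := by
        simp only [← Finset.sum_mul, hrow, one_mul]
    _ ≤ ∑ i, ∑ j, ⟪e i, v j⟫ ^ 2 * (Real.arctan (μ j) + (1 + μ j ^ 2)⁻¹ * (d i - μ j)) := by
        gcongr with i _ j _
        exact arctan_le_tangent (hd i) (hμ j)
    _ = ∑ j, ∑ i, ((Real.arctan (μ j) - (1 + μ j ^ 2)⁻¹ * μ j) * ⟪e i, v j⟫ ^ 2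
          + (1 + μ j ^ 2)⁻¹ * (d i * ⟪e i, v j⟫ ^ 2)) := by
        rw [Finset.sum_comm]
        exact Finset.sum_congr rfl fun j _ => Finset.sum_congr rfl fun i _ => by ring
    _ = _ := by
        refine Finset.sum_congr rfl fun j _ => ?_
        rw [Finset.sum_add_distrib, ← Finset.mul_sum, ← Finset.mul_sum, hcol, ← diagForm_self]
        ring

theorem arctan_rotate {d : ℝ} (hd : 0 < d) :
    Real.arctan ((Real.cos (Real.pi / 4) - d) / Real.sin (Real.pi / 4)) =
      Real.arctan ((d⁻¹ - Real.cos (Real.pi / 4)) / Real.sin (Real.pi / 4)) - Real.pi / 4 := by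
  have hs : 0 < √2 := by positivity
  have hsq : √2 ^ 2 = 2 := Real.sq_sqrt zero_le_two
  have hleft : (√2 / 2 - d) / (√2 / 2) = 1 - √2 * d := by
    field_simp
    linear_combination d * hsq
  have hright : (d⁻¹ - √2 / 2) / (√2 / 2) = √2 / d - 1 := by
    field_simp
    linear_combination (-1 : ℝ) * hsq
  have hlt : (1 - √2 * d) * 1 < 1 := by nlinarith [mul_pos hs hd]
  rw [Real.cos_pi_div_four, Real.sin_pi_div_four, hleft, hright, eq_sub_iff_add_eq,
    ← Real.arctan_one, Real.arctan_add hlt]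
  congr 1
  have : 1 - (1 - √2 * d) * 1 = √2 * d := by ring
  rw [this]
  field_simp
  linear_combination (-1 : ℝ) * hsq

theorem formPhase_rotate (e : OrthonormalBasis (Fin n) ℝ 𝔼) {d : Fin n → ℝ} (hd : ∀ i, 0 < d i) :
    formPhase ((Real.sin (Real.pi / 4))⁻¹ •
        (Real.cos (Real.pi / 4) • innerForm 𝔼 - diagForm e d)) =
      formPhase ((Real.sin (Real.pi / 4))⁻¹ •
        (diagForm e d⁻¹ - Real.cos (Real.pi / 4) • innerForm 𝔼)) - n * Real.pi / 4 := by
  simp only [← diagForm_one e, ← diagForm_smul, ← diagForm_sub, formPhase_diagForm]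
  calc _ = ∑ i, (Real.arctan (((d i)⁻¹ - Real.cos (Real.pi / 4)) / Real.sin (Real.pi / 4))
        - Real.pi / 4) := Finset.sum_congr rfl fun i _ => by
          rw [← arctan_rotate (hd i)]
          simp [div_eq_inv_mul]
    _ = _ := by
      simp only [Finset.sum_sub_distrib, Pi.smul_apply, Pi.sub_apply, Pi.inv_apply, Pi.one_apply,
        smul_eq_mul, mul_one, div_eq_inv_mul, Finset.sum_const, Finset.card_univ, Fintype.card_fin,
        nsmul_eq_mul]
      ring

end Phase

theorem tendsto_const_add_nhds_zero {E : Type*} [TopologicalSpace E] [AddZeroClass E]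
    [ContinuousAdd E] (x : E) : Tendsto (fun h : E => x + h) (𝓝 0) (𝓝 x) := by
  simpa using (continuous_const_add x).tendsto 0

section Paraboloids

variable {E : Type*} [NormedAddCommGroup E] [InnerProductSpace ℝ E] {f : E → ℝ} {x p q : E}
  {a b : E →L[ℝ] E →L[ℝ] ℝ}

/-- Near `x`, the graph of `f` lies above the paraboloid through `(x, f x)` with slope `p` and
Hessian `b`; in the language of viscosity solutions, `(p, b)` is a second-order subjet. -/
def IsLowerParaboloid (f : E → ℝ) (x p : E) (b : E →L[ℝ] E →L[ℝ] ℝ) : Prop :=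
  ∀ᶠ h in 𝓝 (0 : E), f x + ⟪p, h⟫ + b h h / 2 ≤ f (x + h)

/-- Near `x`, the graph of `f` lies below the paraboloid through `(x, f x)` with slope `p` and
Hessian `b`; in the language of viscosity solutions, `(p, b)` is a second-order superjet. -/
def IsUpperParaboloid (f : E → ℝ) (x p : E) (b : E →L[ℝ] E →L[ℝ] ℝ) : Prop :=
  ∀ᶠ h in 𝓝 (0 : E), f (x + h) ≤ f x + ⟪p, h⟫ + b h h / 2

/-- The second-order Peano expansion `f (x + h) = f x + ⟪p, h⟫ + b h h / 2 + o(‖h‖²)`, expressed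
by squeezing `f` between paraboloids. -/
structure HasSecondOrderExpansion (f : E → ℝ) (x p : E) (b : E →L[ℝ] E →L[ℝ] ℝ) : Prop where
  symm : IsSymmForm b
  lower : ∀ ε : ℝ, 0 < ε → IsLowerParaboloid f x p (b - ε • innerForm E)
  upper : ∀ ε : ℝ, 0 < ε → IsUpperParaboloid f x p (b + ε • innerForm E)

theorem IsLowerParaboloid.mono (h : IsLowerParaboloid f x p b) (hab : ∀ k, a k k ≤ b k k) :
    IsLowerParaboloid f x p a :=
  Eventually.mono h fun k hk => by linarith [hab k]

theorem IsUpperParaboloid.mono (h : IsUpperParaboloid f x p a) (hab : ∀ k, a k k ≤ b k k) :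
    IsUpperParaboloid f x p b :=
  Eventually.mono h fun k hk => by linarith [hab k]

theorem eq_zero_and_nonpos_of_eventually_add_sq_nonpos {α β : ℝ}
    (h : ∀ᶠ t in 𝓝 (0 : ℝ), α * t + β * t ^ 2 ≤ 0) : α = 0 ∧ β ≤ 0 := by
  have hderiv : HasDerivAt (fun t : ℝ => α * t + β * t ^ 2) α 0 := by
    simpa using
      ((hasDerivAt_id' (0 : ℝ)).const_mul α).fun_add ((hasDerivAt_pow 2 (0 : ℝ)).const_mul β)
  have hα : α = 0 := IsLocalMax.hasDerivAt_eq_zero (h.mono fun t ht => by simpa using ht) hderiv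
  obtain ⟨t, ht, htpos⟩ :=
    ((h.filter_mono nhdsWithin_le_nhds).and (self_mem_nhdsWithin (s := Ioi (0 : ℝ)))).exists
  refine ⟨hα, nonpos_of_mul_nonpos_left ?_ (pow_pos htpos 2)⟩
  simpa [hα] using ht

theorem IsLowerParaboloid.eq_and_le (hlow : IsLowerParaboloid f x p a)
    (hup : IsUpperParaboloid f x q b) : p = q ∧ ∀ k, a k k ≤ b k k := by
  have hline (k : E) : ⟪p - q, k⟫ = 0 ∧ (a k k - b k k) / 2 ≤ 0 := by
    have hlim : Tendsto (fun t : ℝ => t • k) (𝓝 0) (𝓝 0) := by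
      simpa using (by fun_prop : Continuous fun t : ℝ => t • k).tendsto 0
    refine eq_zero_and_nonpos_of_eventually_add_sq_nonpos ?_
    filter_upwards [hlim.eventually hlow, hlim.eventually hup] with t hl hu
    simp only [inner_smul_right, map_smul, smul_apply, smul_eq_mul, inner_sub_left] at hl hu ⊢
    linarith
  exact ⟨sub_eq_zero.mp (inner_self_eq_zero.mp (hline (p - q)).1), fun k => by linarith [hline k]⟩

theorem IsLowerParaboloid.eq_of_hasGradientAt [CompleteSpace E] (hlow : IsLowerParaboloid f x p b)
    (hf : HasGradientAt f q x) : p = q := by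
  have hmin : IsLocalMin (fun h => f (x + h) - ⟪p, h⟫ - b h h / 2) 0 :=
    Eventually.mono hlow fun h hh => by simp only [add_zero, inner_zero_right, map_zero]; linarith
  have hquad : HasFDerivAt (fun h => b h h / 2) (0 : E →L[ℝ] ℝ) 0 := by
    have := ((b.hasFDerivAt (x := 0)).clm_apply (hasFDerivAt_id (0 : E))).mul_const (2⁻¹ : ℝ)
    simpa [div_eq_mul_inv] using this
  have hderiv := (((hasFDerivAt_comp_add_left x).mpr (by simpa using hf.hasFDerivAt)).sub
    (innerSL ℝ p).hasFDerivAt).sub hquad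
  have hzero := hmin.hasFDerivAt_eq_zero hderiv
  rw [sub_zero, sub_eq_zero] at hzero
  exact (InnerProductSpace.toDual ℝ E).injective hzero.symm

theorem mul_add_sq_sub_paraboloid (f : E → ℝ) (x p h : E) (b : E →L[ℝ] E →L[ℝ] ℝ) (r m : ℝ) :
    (r * f (x + h) + m / 2 * ‖x + h‖ ^ 2) - (r * f x + m / 2 * ‖x‖ ^ 2 + ⟪r • p + m • x, h⟫ +
      (r • b + m • innerForm E) h h / 2) = r * (f (x + h) - (f x + ⟪p, h⟫ + b h h / 2)) := by
  simp only [add_apply, smul_apply, innerForm_self, norm_add_sq_real, inner_add_left,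
    real_inner_smul_left, smul_eq_mul]
  ring

theorem IsLowerParaboloid.mul_add_sq {r : ℝ} (h : IsLowerParaboloid f x p b) (hr : 0 ≤ r)
    (m : ℝ) : IsLowerParaboloid (fun z => r * f z + m / 2 * ‖z‖ ^ 2) x (r • p + m • x)
      (r • b + m • innerForm E) :=
  Eventually.mono h fun k hk => sub_nonneg.mp <|
    (mul_nonneg hr (sub_nonneg.mpr hk)).trans_eq (mul_add_sq_sub_paraboloid f x p k b r m).symm

theorem IsUpperParaboloid.mul_add_sq {r : ℝ} (h : IsUpperParaboloid f x p b) (hr : 0 ≤ r)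
    (m : ℝ) : IsUpperParaboloid (fun z => r * f z + m / 2 * ‖z‖ ^ 2) x (r • p + m • x)
      (r • b + m • innerForm E) :=
  Eventually.mono h fun k hk => sub_nonpos.mp <| (mul_add_sq_sub_paraboloid f x p k b r m).trans_le
    (mul_nonpos_of_nonneg_of_nonpos hr (sub_nonpos.mpr hk))

theorem IsLowerParaboloid.mul_add_sq_of_nonpos {r : ℝ} (h : IsLowerParaboloid f x p b)
    (hr : r ≤ 0) (m : ℝ) : IsUpperParaboloid (fun z => r * f z + m / 2 * ‖z‖ ^ 2) x
      (r • p + m • x) (r • b + m • innerForm E) :=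
  Eventually.mono h fun k hk => sub_nonpos.mp <| (mul_add_sq_sub_paraboloid f x p k b r m).trans_le
    (mul_nonpos_of_nonpos_of_nonneg hr (sub_nonneg.mpr hk))

theorem IsUpperParaboloid.mul_add_sq_of_nonpos {r : ℝ} (h : IsUpperParaboloid f x p b)
    (hr : r ≤ 0) (m : ℝ) : IsLowerParaboloid (fun z => r * f z + m / 2 * ‖z‖ ^ 2) x
      (r • p + m • x) (r • b + m • innerForm E) :=
  Eventually.mono h fun k hk => sub_nonneg.mp <|
    (mul_nonneg_of_nonpos_of_nonpos hr (sub_nonpos.mpr hk)).trans_eq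
      (mul_add_sq_sub_paraboloid f x p k b r m).symm

theorem HasSecondOrderExpansion.mul_add_sq {r : ℝ} (h : HasSecondOrderExpansion f x p b)
    (hr : 0 < r) (m : ℝ) : HasSecondOrderExpansion (fun z => r * f z + m / 2 * ‖z‖ ^ 2) x
      (r • p + m • x) (r • b + m • innerForm E) where
  symm := (h.symm.smul r).add (isSymmForm_innerForm.smul m)
  lower ε hε := ((h.lower (ε / r) (div_pos hε hr)).mul_add_sq hr.le m).mono fun k => by
    simp only [add_apply, sub_apply, smul_apply, smul_eq_mul, mul_sub, ← mul_assoc,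
      mul_div_cancel₀ _ hr.ne']
    exact (sub_add_eq_add_sub _ _ _).ge
  upper ε hε := ((h.upper (ε / r) (div_pos hε hr)).mul_add_sq hr.le m).mono fun k => by
    simp only [add_apply, smul_apply, smul_eq_mul, mul_add, ← mul_assoc, mul_div_cancel₀ _ hr.ne']
    exact (add_right_comm _ _ _).le

end Paraboloids

section Taylor

variable {E : Type*} [NormedAddCommGroup E]

theorem eventually_abs_sub_le_of_fderiv_isLittleO [NormedSpace ℝ E] {g : E → ℝ}
    {g' : E → E →L[ℝ] ℝ} (hg : ∀ᶠ h in 𝓝 0, HasFDerivAt g (g' h) h)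
    (hg' : g' =o[𝓝 0] fun h => h) {ε : ℝ} (hε : 0 < ε) :
    ∀ᶠ h in 𝓝 0, |g h - g 0| ≤ ε * ‖h‖ ^ 2 := by
  obtain ⟨δ, hδ, hball⟩ := Metric.eventually_nhds_iff_ball.mp (hg.and (hg'.def hε))
  filter_upwards [ball_mem_nhds 0 hδ] with h hh
  have hsub : closedBall (0 : E) ‖h‖ ⊆ ball 0 δ :=
    closedBall_subset_ball (mem_ball_zero_iff.mp hh)
  have hbound : ∀ k ∈ closedBall (0 : E) ‖h‖, ‖g' k‖ ≤ ε * ‖h‖ := fun k hk =>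
    (hball k (hsub hk)).2.trans
      (mul_le_mul_of_nonneg_left (mem_closedBall_zero_iff.mp hk) hε.le)
  have := (convex_closedBall (0 : E) ‖h‖).norm_image_sub_le_of_norm_hasFDerivWithin_le
    (fun k hk => (hball k (hsub hk)).1.hasFDerivWithinAt) hbound
    (mem_closedBall_self (norm_nonneg h)) (mem_closedBall_zero_iff.mpr le_rfl)
  rwa [sub_zero, Real.norm_eq_abs, mul_assoc, ← sq] at this

theorem eventually_abs_taylor_two_le [NormedSpace ℝ E] {f : E → ℝ} {f' : E → E →L[ℝ] ℝ}
    {f'' : E →L[ℝ] E →L[ℝ] ℝ} {x : E} (hf : ∀ᶠ y in 𝓝 x, HasFDerivAt f (f' y) y)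
    (hx : HasFDerivAt f' f'' x) {ε : ℝ} (hε : 0 < ε) :
    ∀ᶠ h in 𝓝 0, |f (x + h) - (f x + f' x h + f'' h h / 2)| ≤ ε * ‖h‖ ^ 2 := by
  have hsymm : ∀ v w, f'' v w = f'' w v := second_derivative_symmetric_of_eventually hf hx
  have hderiv : ∀ᶠ h in 𝓝 0, HasFDerivAt (fun h => f (x + h) - f' x h - f'' h h / 2)
      (f' (x + h) - f' x - f'' h) h := by
    filter_upwards [(tendsto_const_add_nhds_zero x).eventually hf] with h hh
    have hquad : HasFDerivAt (fun h => f'' h h / 2) (f'' h) h := by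
      have := ((f''.hasFDerivAt (x := h)).clm_apply (hasFDerivAt_id h)).mul_const (2⁻¹ : ℝ)
      simp only [← div_eq_mul_inv] at this
      refine this.congr_fderiv ?_
      ext v
      simp only [ContinuousLinearMap.comp_id, id_eq, smul_add, add_apply, smul_apply, smul_eq_mul,
        ContinuousLinearMap.flip_apply, hsymm v h]
      ring
    exact (((hasFDerivAt_comp_add_left x).mpr hh).sub (f' x).hasFDerivAt).sub hquad
  filter_upwards [eventually_abs_sub_le_of_fderiv_isLittleO hderiv
    (hasFDerivAt_iff_isLittleO_nhds_zero.mp hx) hε] with h hh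
  convert hh using 2
  simp only [add_zero, map_zero, sub_zero, zero_div]
  ring

variable [InnerProductSpace ℝ E] [CompleteSpace E]

theorem hasSecondOrderExpansion_of_hasFDerivAt {f : E → ℝ} {f' : E → E →L[ℝ] ℝ}
    {f'' : E →L[ℝ] E →L[ℝ] ℝ} {x : E} (hf : ∀ᶠ y in 𝓝 x, HasFDerivAt f (f' y) y)
    (hx : HasFDerivAt f' f'' x) :
    HasSecondOrderExpansion f x ((InnerProductSpace.toDual ℝ E).symm (f' x)) f'' where
  symm := second_derivative_symmetric_of_eventually hf hx
  lower ε hε := (eventually_abs_taylor_two_le hf hx (half_pos hε)).mono fun h hh => by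
    simp only [sub_apply, smul_apply, innerForm_self, smul_eq_mul,
      InnerProductSpace.toDual_symm_apply]
    linarith [(abs_le.mp hh).1]
  upper ε hε := (eventually_abs_taylor_two_le hf hx (half_pos hε)).mono fun h hh => by
    simp only [add_apply, smul_apply, innerForm_self, smul_eq_mul,
      InnerProductSpace.toDual_symm_apply]
    linarith [(abs_le.mp hh).2]

theorem hasSecondOrderExpansion_of_contDiffAt {φ : E → ℝ} {x : E} (hφ : ContDiffAt ℝ 2 φ x) :
    HasSecondOrderExpansion φ x (gradient φ x) (fderiv ℝ (fderiv ℝ φ) x) := by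
  refine hasSecondOrderExpansion_of_hasFDerivAt ?_
    ((hφ.fderiv_right (m := 1) (by norm_num)).differentiableAt (by simp)).hasFDerivAt
  filter_upwards [hφ.eventually (by simp)] with y hy
  exact (hy.differentiableAt (by simp)).hasFDerivAt

end Taylor

section DiagonalForms

variable {E : Type*} [NormedAddCommGroup E] [InnerProductSpace ℝ E] {ι : Type*} [Fintype ι]

theorem diagForm_le_diagForm (e : OrthonormalBasis ι ℝ E) {d d' : ι → ℝ} (h : ∀ i, d i ≤ d' i)
    (k : E) : diagForm e d k k ≤ diagForm e d' k k := by
  simp only [diagForm_self]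
  gcongr with i
  exact h i

theorem exists_pos_mul_norm_sq_le_diagForm (e : OrthonormalBasis ι ℝ E) {d : ι → ℝ}
    (hd : ∀ i, 0 < d i) : ∃ a > 0, ∀ k, a * ‖k‖ ^ 2 ≤ diagForm e d k k := by
  obtain ⟨a, ha, had⟩ : ∃ a > 0, ∀ i, a ≤ d i := by
    rcases isEmpty_or_nonempty ι with hι | hι
    · exact ⟨1, one_pos, fun i => hι.elim i⟩
    · obtain ⟨i, hi⟩ := Finite.exists_min d
      exact ⟨d i, hd i, hi⟩
  refine ⟨a, ha, fun k => mul_norm_sq_le_diagForm e (I := univ) (fun i _ => had i) ?_⟩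
  simpa [e.toBasis.span_eq] using (e.coe_toBasis ▸ e.toBasis.span_eq ▸ Submodule.mem_top :
    k ∈ Submodule.span ℝ (range e))

/-- The symmetric operator with eigenbasis `e` and eigenvalues `d`. -/
def diagMap (e : OrthonormalBasis ι ℝ E) (d : ι → ℝ) : E →L[ℝ] E :=
  ∑ i, d i • (innerSL ℝ (e i)).smulRight (e i)

theorem inner_basis_diagMap (e : OrthonormalBasis ι ℝ E) (d : ι → ℝ) (i : ι) (h : E) :
    ⟪e i, diagMap e d h⟫ = d i * ⟪e i, h⟫ := by
  classical simp [diagMap, inner_sum, inner_smul_right, e.inner_eq_ite]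

theorem inner_diagMap_self (e : OrthonormalBasis ι ℝ E) (d : ι → ℝ) (h : E) :
    ⟪h, diagMap e d h⟫ = diagForm e d h h := by
  rw [← e.sum_inner_mul_inner, diagForm_self]
  refine Finset.sum_congr rfl fun i _ => ?_
  rw [inner_basis_diagMap, real_inner_comm]
  ring

theorem diagForm_diagMap_inv (e : OrthonormalBasis ι ℝ E) {d : ι → ℝ} (hd : ∀ i, d i ≠ 0)
    (h : E) : diagForm e d (diagMap e d⁻¹ h) (diagMap e d⁻¹ h) = diagForm e d⁻¹ h h := by
  rw [diagForm_self, diagForm_self]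
  refine Finset.sum_congr rfl fun i _ => ?_
  rw [inner_basis_diagMap, Pi.inv_apply]
  field_simp [hd i]

theorem inner_le_diagForm_add_diagForm_inv (e : OrthonormalBasis ι ℝ E) {d : ι → ℝ}
    (hd : ∀ i, 0 < d i) (h k : E) :
    ⟪h, k⟫ ≤ diagForm e d k k / 2 + diagForm e d⁻¹ h h / 2 := by
  rw [← e.sum_inner_mul_inner h k, diagForm_self, diagForm_self, Finset.sum_div, Finset.sum_div,
    ← Finset.sum_add_distrib]
  refine Finset.sum_le_sum fun i _ => ?_
  have hdi := hd i
  have hsq : 0 ≤ (d i)⁻¹ * (d i * ⟪e i, k⟫ - ⟪e i, h⟫) ^ 2 := by positivity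
  have hexpand : (d i)⁻¹ * (d i * ⟪e i, k⟫ - ⟪e i, h⟫) ^ 2 =
      d i * ⟪e i, k⟫ ^ 2 + (d i)⁻¹ * ⟪e i, h⟫ ^ 2 - 2 * (⟪e i, h⟫ * ⟪e i, k⟫) := by
    field_simp
    ring
  rw [real_inner_comm (e i) h, Pi.inv_apply]
  linarith

end DiagonalForms

section Subgradients

theorem exists_clm_forall_add_le {E : Type*} [NormedAddCommGroup E] [NormedSpace ℝ E] {Ω : Set E}
    (hΩ : IsOpen Ω) {f : E → ℝ} (hf : ConvexOn ℝ Ω f) (hcont : ContinuousOn f Ω) {x : E}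
    (hx : x ∈ Ω) : ∃ g : E →L[ℝ] ℝ, ∀ z ∈ Ω, f x + g (z - x) ≤ f z := by
  have hopen : IsOpen {p : E × ℝ | p.1 ∈ Ω ∧ f p.1 < p.2} := by
    have hdiff : ContinuousOn (fun p : E × ℝ => p.2 - f p.1) (Prod.fst ⁻¹' Ω) :=
      continuousOn_snd.sub (hcont.comp continuousOn_fst fun p hp => hp)
    have hset : {p : E × ℝ | p.1 ∈ Ω ∧ f p.1 < p.2} =
        Prod.fst ⁻¹' Ω ∩ (fun p : E × ℝ => p.2 - f p.1) ⁻¹' Ioi 0 :=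
      Set.ext fun p => and_congr_right' sub_pos.symm
    rw [hset]
    exact hdiff.isOpen_inter_preimage (hΩ.preimage continuous_fst) isOpen_Ioi
  obtain ⟨L, hL⟩ := geometric_hahn_banach_open_point hf.convex_strict_epigraph hopen
    (show (x, f x) ∉ _ from fun h => lt_irrefl _ h.2)
  have hsplit (z : E) (t : ℝ) : L (z, t) = L (z, 0) + t * L (0, 1) := by
    rw [← smul_eq_mul, ← map_smul, ← map_add]
    simp
  have hvert : L (0, 1) < 0 := by
    have := hL (x, f x + 1) ⟨hx, lt_add_one _⟩
    rw [hsplit x (f x + 1), hsplit x (f x)] at this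
    linarith
  have hgraph (z : E) (hz : z ∈ Ω) : L (z, f z) ≤ L (x, f x) := by
    have hlim : Tendsto (fun ε : ℝ => L (z, f z + ε)) (𝓝[>] 0) (𝓝 (L (z, f z))) := by
      have : Continuous fun ε : ℝ => L (z, f z + ε) := by fun_prop
      simpa using (this.tendsto 0).mono_left nhdsWithin_le_nhds
    refine le_of_tendsto hlim (eventually_mem_nhdsWithin.mono fun ε hε => ?_)
    exact (hL (z, f z + ε) ⟨hz, lt_add_of_pos_right _ hε⟩).le
  refine ⟨(-L (0, 1))⁻¹ • L.comp (ContinuousLinearMap.inl ℝ E ℝ), fun z hz => ?_⟩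
  have hslope : L (z - x, 0) = L (z, 0) - L (x, 0) := by
    rw [← map_sub, Prod.mk_sub_mk, sub_zero]
  have hle := hgraph z hz
  rw [hsplit z, hsplit x] at hle
  rw [← le_sub_iff_add_le']
  simp only [smul_apply, ContinuousLinearMap.comp_apply, ContinuousLinearMap.inl_apply, smul_eq_mul]
  rw [inv_mul_le_iff₀ (neg_pos.mpr hvert), hslope]
  linarith

variable {n : ℕ}

local notation "𝔼" => EuclideanSpace ℝ (Fin n)

variable {Ω K : Set (EuclideanSpace ℝ (Fin n))} {f : EuclideanSpace ℝ (Fin n) → ℝ}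
  {x y z : EuclideanSpace ℝ (Fin n)}

theorem exists_mem_subdifferential (hΩ : IsOpen Ω) (hf : ConvexOn ℝ Ω f) (hx : x ∈ Ω) :
    ∃ y, y ∈ subdifferential Ω f x := by
  obtain ⟨g, hg⟩ := exists_clm_forall_add_le hΩ hf (hf.continuousOn hΩ) hx
  refine ⟨(InnerProductSpace.toDual ℝ 𝔼).symm g, fun z hz => ?_⟩
  rw [InnerProductSpace.toDual_symm_apply]
  exact hg z hz

theorem mem_subdifferential_iff_isMinOn :
    y ∈ subdifferential Ω f x ↔ IsMinOn (fun z => f z - ⟪y, z⟫) Ω x := by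
  refine forall₂_congr fun z _ => ?_
  change _ ↔ f x - ⟪y, x⟫ ≤ f z - ⟪y, z⟫
  rw [inner_sub_right]
  constructor <;> intro h <;> linarith

theorem exists_mem_subdifferential_of_isCompact (hK : IsCompact K) (hne : K.Nonempty)
    (hf : ContinuousOn f K) (y : 𝔼) : ∃ x ∈ K, y ∈ subdifferential K f x := by
  simp only [mem_subdifferential_iff_isMinOn]
  exact hK.exists_isMinOn hne (hf.sub (by fun_prop))

theorem isLowerParaboloid_zero_of_mem_subdifferential (hΩ : Ω ∈ 𝓝 x)
    (hy : y ∈ subdifferential Ω f x) : IsLowerParaboloid f x y 0 := by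
  filter_upwards [(tendsto_const_add_nhds_zero x).eventually hΩ] with h hh
  simpa using hy (x + h) hh

/-- The range of the subdifferential of a function `f` with domain `Ω`. -/
def subgradientImage (Ω : Set 𝔼) (f : 𝔼 → ℝ) : Set 𝔼 := ⋃ x ∈ Ω, subdifferential Ω f x

theorem mem_subgradientImage :
    y ∈ subgradientImage Ω f ↔ ∃ x ∈ Ω, y ∈ subdifferential Ω f x := by
  simp only [subgradientImage, mem_iUnion, exists_prop]

theorem legendre_eq_of_mem_subdifferential (hx : x ∈ Ω) (hy : y ∈ subdifferential Ω f x) :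
    legendre Ω f y = ⟪x, y⟫ - f x := by
  have hgreatest := isGreatest_legendre hx hy
  refine le_antisymm ?_ (hgreatest.2 ⟨x, hx, rfl⟩)
  obtain ⟨z, hz, hzy⟩ := hgreatest.1
  have hmin := mem_subdifferential_iff_isMinOn.mp hy hz
  simp only [mem_ofPred_eq, real_inner_comm _ y] at hmin
  rw [← hzy]
  linarith

theorem inner_le_add_legendre (hy : y ∈ subgradientImage Ω f) (hz : z ∈ Ω) :
    ⟪z, y⟫ ≤ f z + legendre Ω f y := by
  obtain ⟨x, hx, hxy⟩ := mem_subgradientImage.mp hy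
  exact sub_le_iff_le_add'.mp ((isGreatest_legendre hx hxy).2 ⟨z, hz, rfl⟩)

theorem mem_subdifferential_legendre (hx : x ∈ Ω) (hy : y ∈ subdifferential Ω f x) :
    x ∈ subdifferential (subgradientImage Ω f) (legendre Ω f) y := by
  intro z hz
  rw [legendre_eq_of_mem_subdifferential hx hy, inner_sub_right]
  linarith [inner_le_add_legendre hz hx]

theorem legendre_add_smul_le {k : 𝔼} {t : ℝ} (ht : t ∈ Icc 0 1) (hy : y ∈ subgradientImage Ω f)
    (hk : y + k ∈ subgradientImage Ω f) (htk : y + t • k ∈ subgradientImage Ω f) :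
    legendre Ω f (y + t • k) ≤ (1 - t) * legendre Ω f y + t * legendre Ω f (y + k) := by
  obtain ⟨x, hx, hxy⟩ := mem_subgradientImage.mp htk
  have hleft := mul_le_mul_of_nonneg_left (inner_le_add_legendre hy hx) (sub_nonneg.mpr ht.2)
  have hright := mul_le_mul_of_nonneg_left (inner_le_add_legendre hk hx) ht.1
  rw [legendre_eq_of_mem_subdifferential hx hxy]
  rw [inner_add_right] at hright ⊢
  rw [inner_smul_right]
  linarith

end Subgradients

section StrongConvexity

variable {n : ℕ}

local notation "𝔼" => EuclideanSpace ℝ (Fin n)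

variable {Ω : Set (EuclideanSpace ℝ (Fin n))} {F u : EuclideanSpace ℝ (Fin n) → ℝ} {m : ℝ}
  {x y z : EuclideanSpace ℝ (Fin n)}

theorem add_sq_le_of_mem_subdifferential (hF : StrongConvexOn Ω m F) (hx : x ∈ Ω)
    (hy : y ∈ subdifferential Ω F x) (hz : z ∈ Ω) :
    F x + ⟪y, z - x⟫ + m / 2 * ‖z - x‖ ^ 2 ≤ F z := by
  have hsegment : ∀ t : ℝ, 0 < t → t < 1 →
      F x + ⟪y, z - x⟫ + (1 - t) * (m / 2 * ‖z - x‖ ^ 2) ≤ F z := by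
    intro t ht ht1
    have hconv := hF.2 hz hx ht.le (sub_nonneg.mpr ht1.le) (add_sub_cancel t 1)
    have hsub := hy _ (hF.1 hz hx ht.le (sub_nonneg.mpr ht1.le) (add_sub_cancel t 1))
    rw [show t • z + (1 - t) • x - x = t • (z - x) by module, inner_smul_right] at hsub
    simp only [smul_eq_mul] at hconv
    refine le_of_mul_le_mul_left ?_ ht
    linarith
  have hlim : Tendsto (fun t : ℝ => F x + ⟪y, z - x⟫ + (1 - t) * (m / 2 * ‖z - x‖ ^ 2))
      (𝓝[>] 0) (𝓝 (F x + ⟪y, z - x⟫ + (1 - 0) * (m / 2 * ‖z - x‖ ^ 2))) :=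
    (Continuous.tendsto (by fun_prop) 0).mono_left nhdsWithin_le_nhds
  rw [sub_zero, one_mul] at hlim
  refine le_of_tendsto hlim ?_
  filter_upwards [Ioo_mem_nhdsGT (zero_lt_one' ℝ)] with t ht
  exact hsegment t ht.1 ht.2

theorem mul_norm_sub_le_of_mem_subdifferential (hF : StrongConvexOn Ω m F) {x₁ x₂ y₁ y₂ : 𝔼}
    (hx₁ : x₁ ∈ Ω) (hx₂ : x₂ ∈ Ω) (hy₁ : y₁ ∈ subdifferential Ω F x₁)
    (hy₂ : y₂ ∈ subdifferential Ω F x₂) : m * ‖x₁ - x₂‖ ≤ ‖y₁ - y₂‖ := by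
  have hgrow₁ := add_sq_le_of_mem_subdifferential hF hx₁ hy₁ hx₂
  have hgrow₂ := add_sq_le_of_mem_subdifferential hF hx₂ hy₂ hx₁
  have hmono : m * ‖x₁ - x₂‖ ^ 2 ≤ ⟪y₁ - y₂, x₁ - x₂⟫ := by
    rw [inner_sub_left]
    rw [← neg_sub x₁ x₂, inner_neg_right, norm_neg] at hgrow₁
    linarith
  rcases (norm_nonneg (x₁ - x₂)).eq_or_lt with hzero | hpos
  · rw [← hzero, mul_zero]
    exact norm_nonneg _
  · refine le_of_mul_le_mul_right ?_ hpos
    rw [mul_assoc, ← sq]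
    exact hmono.trans (real_inner_le_norm _ _)

theorem exists_mem_subdifferential_of_norm_lt (hF : StrongConvexOn Ω m F) (hm : 0 < m)
    (hcont : ContinuousOn F Ω) {x₀ y₀ : 𝔼} {r : ℝ} (hr : 0 < r) (hball : closedBall x₀ r ⊆ Ω)
    (hy₀ : y₀ ∈ subdifferential Ω F x₀) (hy : ‖y - y₀‖ < m * r / 2) :
    ∃ x ∈ closedBall x₀ r, y ∈ subdifferential Ω F x := by
  have hx₀ : x₀ ∈ closedBall x₀ r := mem_closedBall_self hr.le
  obtain ⟨x, hx, hmin⟩ := (isCompact_closedBall x₀ r).exists_isMinOn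
    (f := fun z => F z - ⟪y, z⟫) ⟨x₀, hx₀⟩ ((hcont.mono hball).sub (by fun_prop))
  refine ⟨x, hx, mem_subdifferential_iff_isMinOn.mpr ?_⟩
  have hinterior : x ∈ ball x₀ r := by
    refine lt_of_le_of_ne (mem_closedBall.mp hx) fun heq => ?_
    rw [dist_eq_norm] at heq
    have hgrow := add_sq_le_of_mem_subdifferential hF (hball hx₀) hy₀ (hball hx)
    have hle : F x - ⟪y, x⟫ ≤ F x₀ - ⟪y, x₀⟫ := hmin hx₀
    have hinner : ⟪y - y₀, x - x₀⟫ ≤ ‖y - y₀‖ * r := heq ▸ real_inner_le_norm _ _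
    have hslope := mul_lt_mul_of_pos_right hy hr
    rw [inner_sub_left, inner_sub_right y] at hinner
    rw [heq] at hgrow
    linarith
  have hloc : IsLocalMinOn (fun z => F z - ⟪y, z⟫) Ω x :=
    (Eventually.mono (isOpen_ball.mem_nhds hinterior) fun z hz =>
      hmin (ball_subset_closedBall hz)).filter_mono nhdsWithin_le_nhds
  exact IsMinOn.of_isLocalMinOn_of_convexOn (hball hx) hloc
    ((hF.convexOn fun t => by positivity).sub ((innerSL ℝ y).toLinearMap.concaveOn hF.1))

theorem isOpen_subgradientImage (hF : StrongConvexOn Ω m F) (hm : 0 < m) (hΩ : IsOpen Ω) :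
    IsOpen (subgradientImage Ω F) := by
  have hcont := (hF.convexOn fun t => by positivity).continuousOn hΩ
  refine isOpen_iff_mem_nhds.mpr fun y₀ hy₀ => ?_
  obtain ⟨x₀, hx₀, hy⟩ := mem_subgradientImage.mp hy₀
  obtain ⟨r, hr, hball⟩ := nhds_basis_closedBall.mem_iff.mp (hΩ.mem_nhds hx₀)
  refine mem_of_superset (ball_mem_nhds y₀ (show 0 < m * r / 2 by positivity)) fun y hy' => ?_
  obtain ⟨x, hx, hxy⟩ := exists_mem_subdifferential_of_norm_lt hF hm hcont hr hball hy
    (mem_ball_iff_norm.mp hy')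
  exact mem_subgradientImage.mpr ⟨x, hball hx, hxy⟩

theorem hasGradientAt_legendre (hF : StrongConvexOn Ω m F) (hm : 0 < m) (hΩ : IsOpen Ω)
    (hx : x ∈ Ω) (hy : y ∈ subdifferential Ω F x) : HasGradientAt (legendre Ω F) x y := by
  rw [hasGradientAt_iff_isLittleO, Asymptotics.isLittleO_iff]
  intro ε hε
  have hyD : y ∈ subgradientImage Ω F := mem_subgradientImage.mpr ⟨x, hx, hy⟩
  filter_upwards [(isOpen_subgradientImage hF hm hΩ).mem_nhds hyD,
    ball_mem_nhds y (mul_pos hm hε)] with y' hy' hball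
  obtain ⟨x', hx', hxy'⟩ := mem_subgradientImage.mp hy'
  have hlower := mem_subdifferential_legendre hx hy y' hy'
  have hupper := mem_subdifferential_legendre hx' hxy' y hyD
  have hclose : ‖x' - x‖ ≤ ε := le_of_mul_le_mul_left
    ((mul_norm_sub_le_of_mem_subdifferential hF hx' hx hxy' hy).trans
      (mem_ball_iff_norm.mp hball).le) hm
  have hinner : ⟪x' - x, y' - y⟫ ≤ ε * ‖y' - y‖ := (real_inner_le_norm _ _).trans
    (mul_le_mul_of_nonneg_right hclose (norm_nonneg _))
  rw [inner_sub_left] at hinner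
  rw [← neg_sub y' y, inner_neg_right] at hupper
  rw [Real.norm_eq_abs, abs_le]
  constructor <;> linarith [mul_nonneg hε.le (norm_nonneg (y' - y))]

theorem lipschitzOnWith_gradient_legendre (hF : StrongConvexOn Ω m F) (hm : 0 < m)
    (hΩ : IsOpen Ω) :
    LipschitzOnWith (m⁻¹).toNNReal (gradient (legendre Ω F)) (subgradientImage Ω F) := by
  refine LipschitzOnWith.of_dist_le_mul fun y hy y' hy' => ?_
  obtain ⟨x, hx, hxy⟩ := mem_subgradientImage.mp hy
  obtain ⟨x', hx', hxy'⟩ := mem_subgradientImage.mp hy'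
  rw [(hasGradientAt_legendre hF hm hΩ hx hxy).gradient,
    (hasGradientAt_legendre hF hm hΩ hx' hxy').gradient, Real.coe_toNNReal _ (by positivity),
    dist_eq_norm, dist_eq_norm, ← div_eq_inv_mul, le_div_iff₀' hm]
  exact mul_norm_sub_le_of_mem_subdifferential hF hx hx' hxy hxy'

theorem strongConvexOn_mul_add_sq (hu : ConvexOn ℝ Ω u) {a : ℝ} (ha : 0 ≤ a) (m : ℝ) :
    StrongConvexOn Ω m fun x => a * u x + m / 2 * ‖x‖ ^ 2 := by
  rw [strongConvexOn_iff_convex]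
  simpa using hu.smul ha

theorem mem_subdifferential_of_mul_add_sq (hu : ConvexOn ℝ Ω u) {a : ℝ} (ha : 0 < a) (hx : x ∈ Ω)
    (hy : y ∈ subdifferential Ω (fun x => a * u x + m / 2 * ‖x‖ ^ 2) x) :
    a⁻¹ • (y - m • x) ∈ subdifferential Ω u x := by
  intro z hz
  have hgrow := add_sq_le_of_mem_subdifferential (strongConvexOn_mul_add_sq hu ha.le m) hx hy hz
  have hsq : ‖z‖ ^ 2 = ‖x‖ ^ 2 + 2 * ⟪x, z - x⟫ + ‖z - x‖ ^ 2 := by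
    rw [← norm_add_sq_real, add_sub_cancel]
  rw [real_inner_smul_left, inner_sub_left, real_inner_smul_left, ← le_sub_iff_add_le',
    inv_mul_le_iff₀ ha]
  rw [hsq] at hgrow
  linarith

end StrongConvexity

section Duality

variable {n : ℕ}

local notation "𝔼" => EuclideanSpace ℝ (Fin n)

variable {Ω : Set (EuclideanSpace ℝ (Fin n))} {F : EuclideanSpace ℝ (Fin n) → ℝ} {m : ℝ}
  {x y : EuclideanSpace ℝ (Fin n)} {d : Fin n → ℝ}

theorem isLowerParaboloid_of_legendre (hΩ : Ω ∈ 𝓝 x) (hD : subgradientImage Ω F ∈ 𝓝 y)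
    (hy : y ∈ subdifferential Ω F x) (e : OrthonormalBasis (Fin n) ℝ 𝔼) (hd : ∀ i, d i ≠ 0)
    (hup : IsUpperParaboloid (legendre Ω F) y x (diagForm e d)) :
    IsLowerParaboloid F x y (diagForm e d⁻¹) := by
  have hlim : Tendsto (diagMap e d⁻¹) (𝓝 0) (𝓝 0) := by
    simpa using (diagMap e d⁻¹).continuous.tendsto 0
  filter_upwards [(tendsto_const_add_nhds_zero x).eventually hΩ,
    ((tendsto_const_add_nhds_zero y).comp hlim).eventually hD, hlim.eventually hup]
    with h hh hk hupk
  -- the slope `y + k` paired with `x + h` in the Fenchel inequality is the gradient at `x + h`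
  -- of the paraboloid dual to the given one
  have hfenchel := inner_le_add_legendre hk hh
  rw [legendre_eq_of_mem_subdifferential (mem_of_mem_nhds hΩ) hy, diagForm_diagMap_inv e hd] at hupk
  rw [Function.comp_apply, inner_add_left, inner_add_right, inner_add_right,
    inner_diagMap_self, real_inner_comm y h] at hfenchel
  linarith

theorem eventually_norm_lt_of_add_mem_subdifferential {b : 𝔼 →L[ℝ] 𝔼 →L[ℝ] ℝ}
    (hD : subgradientImage Ω F ∈ 𝓝 y) (hlow : IsLowerParaboloid (legendre Ω F) y x b) {a : ℝ}
    (ha : 0 < a) (hb : ∀ k, a * ‖k‖ ^ 2 ≤ b k k) {δ : ℝ} (hδ : 0 < δ) :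
    ∀ᶠ h in 𝓝 (0 : 𝔼), x + h ∈ Ω → ∀ k, y + k ∈ subdifferential Ω F (x + h) → ‖k‖ < δ := by
  obtain ⟨r, hr, hball⟩ := Metric.eventually_nhds_iff_ball.mp
    (hlow.and ((tendsto_const_add_nhds_zero y).eventually hD))
  obtain ⟨ρ, hρ, hρδ, hρr⟩ : ∃ ρ > 0, ρ ≤ δ ∧ ρ < r :=
    ⟨min δ (r / 2), by positivity, min_le_left _ _, (min_le_right _ _).trans_lt (half_lt_self hr)⟩
  filter_upwards [ball_mem_nhds (0 : 𝔼) (show 0 < a * ρ / 2 by positivity)] with h hh hxh k hk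
  by_contra! hkδ
  have hkpos : 0 < ‖k‖ := hδ.trans_le hkδ
  have ht : 0 < ρ / ‖k‖ := div_pos hρ hkpos
  have htk : ‖(ρ / ‖k‖) • k‖ = ρ := by
    rw [norm_smul, Real.norm_of_nonneg ht.le, div_mul_cancel₀ _ hkpos.ne']
  obtain ⟨hlowk, hmem⟩ := hball ((ρ / ‖k‖) • k) (by rwa [mem_ball_zero_iff, htk])
  have hkD : y + k ∈ subgradientImage Ω F := mem_subgradientImage.mpr ⟨x + h, hxh, hk⟩
  have hsub := mem_subdifferential_legendre hxh hk y (mem_of_mem_nhds hD)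
  rw [sub_add_cancel_left, inner_neg_right, inner_add_left] at hsub
  have hconv := legendre_add_smul_le ⟨ht.le, (div_le_one hkpos).mpr (hρδ.trans hkδ)⟩
    (mem_of_mem_nhds hD) hkD hmem
  have hquad := hb ((ρ / ‖k‖) • k)
  rw [htk] at hquad
  rw [inner_smul_right] at hlowk
  have hinner : ρ / ‖k‖ * ⟪h, k⟫ ≤ ‖h‖ * ρ := by
    calc ρ / ‖k‖ * ⟪h, k⟫ ≤ ρ / ‖k‖ * (‖h‖ * ‖k‖) :=
          mul_le_mul_of_nonneg_left (real_inner_le_norm h k) ht.le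
      _ = ‖h‖ * ρ := by field_simp
  have hsmall := mul_lt_mul_of_pos_right (mem_ball_zero_iff.mp hh) hρ
  have := mul_le_mul_of_nonneg_left hsub ht.le
  linarith

theorem isUpperParaboloid_of_legendre (hΩ : IsOpen Ω) (hF : ConvexOn ℝ Ω F)
    (hD : subgradientImage Ω F ∈ 𝓝 y) (hx : x ∈ Ω) (hy : y ∈ subdifferential Ω F x)
    (e : OrthonormalBasis (Fin n) ℝ 𝔼) (hd : ∀ i, 0 < d i)
    (hlow : IsLowerParaboloid (legendre Ω F) y x (diagForm e d)) :
    IsUpperParaboloid F x y (diagForm e d⁻¹) := by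
  obtain ⟨a, ha, had⟩ := exists_pos_mul_norm_sq_le_diagForm e hd
  obtain ⟨δ, hδ, hball⟩ := Metric.eventually_nhds_iff_ball.mp hlow
  filter_upwards [(tendsto_const_add_nhds_zero x).eventually (hΩ.mem_nhds hx),
    eventually_norm_lt_of_add_mem_subdifferential hD hlow ha had hδ] with h hh hsmall
  obtain ⟨y', hy'⟩ := exists_mem_subdifferential hΩ hF hh
  obtain ⟨k, rfl⟩ : ∃ k, y' = y + k := ⟨y' - y, (add_sub_cancel y y').symm⟩
  have hlowk := hball k (mem_ball_zero_iff.mpr (hsmall hh k hy'))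
  have hyoung := inner_le_diagForm_add_diagForm_inv e hd h k
  rw [legendre_eq_of_mem_subdifferential hx hy, legendre_eq_of_mem_subdifferential hh hy',
    inner_add_left, inner_add_right, inner_add_right, real_inner_comm y h] at hlowk
  linarith

theorem isUpperParaboloid_legendre (hF : StrongConvexOn Ω m F) (hm : 0 < m)
    (hD : subgradientImage Ω F ∈ 𝓝 y) (hx : x ∈ Ω) (hy : y ∈ subdifferential Ω F x)
    (e : OrthonormalBasis (Fin n) ℝ 𝔼) (hd : ∀ i, 0 < d i)
    (hlow : IsLowerParaboloid F x y (diagForm e d)) :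
    IsUpperParaboloid (legendre Ω F) y x (diagForm e d⁻¹) := by
  obtain ⟨δ, hδ, hball⟩ := Metric.eventually_nhds_iff_ball.mp hlow
  filter_upwards [(tendsto_const_add_nhds_zero y).eventually hD,
    ball_mem_nhds (0 : 𝔼) (mul_pos hm hδ)] with k hk hsmall
  obtain ⟨x', hx', hxy'⟩ := mem_subgradientImage.mp hk
  obtain ⟨h, rfl⟩ : ∃ h, x' = x + h := ⟨x' - x, (add_sub_cancel x x').symm⟩
  have hclose := mul_norm_sub_le_of_mem_subdifferential hF hx' hx hxy' hy
  rw [add_sub_cancel_left, add_sub_cancel_left] at hclose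
  have hlowh := hball h (mem_ball_zero_iff.mpr
    (lt_of_mul_lt_mul_left (hclose.trans_lt (mem_ball_zero_iff.mp hsmall)) hm.le))
  have hyoung := inner_le_diagForm_add_diagForm_inv e hd k h
  rw [legendre_eq_of_mem_subdifferential hx hy, legendre_eq_of_mem_subdifferential hx' hxy',
    inner_add_left, inner_add_right, inner_add_right, real_inner_comm y h, ← real_inner_comm h k]
  linarith

theorem hasSecondOrderExpansion_of_legendre (hΩ : IsOpen Ω) (hF : ConvexOn ℝ Ω F)
    (hD : subgradientImage Ω F ∈ 𝓝 y) (hx : x ∈ Ω) (hy : y ∈ subdifferential Ω F x)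
    (e : OrthonormalBasis (Fin n) ℝ 𝔼) (hd : ∀ i, 0 < d i)
    (hexp : HasSecondOrderExpansion (legendre Ω F) y x (diagForm e d)) :
    HasSecondOrderExpansion F x y (diagForm e d⁻¹) := by
  have hinv (i : Fin n) : Tendsto (fun η : ℝ => (d i + η)⁻¹) (𝓝 0) (𝓝 (d i)⁻¹) :=
    (by simpa using (continuous_const_add (d i)).tendsto 0 :
      Tendsto (fun η : ℝ => d i + η) (𝓝 0) (𝓝 (d i))).inv₀ (hd i).ne'
  have hshift (η : ℝ) : diagForm e d + η • innerForm 𝔼 = diagForm e fun i => d i + η := by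
    rw [← diagForm_one e, ← diagForm_smul, ← diagForm_add]
    simp only [Pi.add_def, Pi.smul_apply, Pi.one_apply, smul_eq_mul, mul_one]
  refine ⟨isSymmForm_diagForm e _, fun ε hε => ?_, fun ε hε => ?_⟩
  · obtain ⟨η, hη, hηpos⟩ := (((eventually_all.mpr fun i => (hinv i).eventually_const_le
      (sub_lt_self (d i)⁻¹ hε)).filter_mono nhdsWithin_le_nhds).and
        (eventually_mem_nhdsWithin (s := Ioi (0 : ℝ)))).exists
    have hup := hexp.upper η hηpos
    rw [hshift] at hup
    refine (isLowerParaboloid_of_legendre (hΩ.mem_nhds hx) hD hy e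
      (fun i => (add_pos (hd i) hηpos).ne') hup).mono ?_
    rw [← diagForm_one e, ← diagForm_smul, ← diagForm_sub]
    exact diagForm_le_diagForm e fun i => by simpa using hη i
  · obtain ⟨η, ⟨hη, hηd⟩, hηneg⟩ := ((((eventually_all.mpr fun i => (hinv i).eventually_le_const
      (lt_add_of_pos_right (d i)⁻¹ hε)).and (eventually_all.mpr fun i =>
        lt_mem_nhds (neg_lt_zero.mpr (hd i)))).filter_mono
          nhdsWithin_le_nhds).and (eventually_mem_nhdsWithin (s := Iio (0 : ℝ)))).exists
    have hlow := hexp.lower (-η) (neg_pos.mpr hηneg)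
    rw [show diagForm e d - (-η) • innerForm 𝔼 = diagForm e d + η • innerForm 𝔼 by ext; simp,
      hshift] at hlow
    refine (isUpperParaboloid_of_legendre hΩ hF hD hx hy e
      (fun i => neg_lt_iff_pos_add'.mp (hηd i)) hlow).mono ?_
    rw [← diagForm_one e, ← diagForm_smul, ← diagForm_add]
    exact diagForm_le_diagForm e fun i => by simpa using hη i

end Duality

section Alexandrov

variable {n : ℕ}

local notation "𝔼" => EuclideanSpace ℝ (Fin n)

variable {Ω : Set (EuclideanSpace ℝ (Fin n))} {F u : EuclideanSpace ℝ (Fin n) → ℝ} {m : ℝ}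
  {x y : EuclideanSpace ℝ (Fin n)}

theorem IsLowerParaboloid.eq_and_le_of_hasSecondOrderExpansion {E : Type*} [NormedAddCommGroup E]
    [InnerProductSpace ℝ E] {f : E → ℝ} {x p q : E} {a b : E →L[ℝ] E →L[ℝ] ℝ}
    (hlow : IsLowerParaboloid f x p a) (hexp : HasSecondOrderExpansion f x q b) :
    p = q ∧ ∀ k, a k k ≤ b k k := by
  have hε (ε : ℝ) (hε : 0 < ε) := hlow.eq_and_le (hexp.upper ε hε)
  refine ⟨(hε 1 one_pos).1, fun k => ?_⟩
  have hlim : Tendsto (fun ε : ℝ => b k k + ε * ‖k‖ ^ 2) (𝓝[>] 0) (𝓝 (b k k)) := by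
    have : Continuous fun ε : ℝ => b k k + ε * ‖k‖ ^ 2 := by fun_prop
    simpa using (this.tendsto 0).mono_left nhdsWithin_le_nhds
  refine ge_of_tendsto hlim (eventually_mem_nhdsWithin.mono fun ε hpos => ?_)
  simpa [innerForm_self] using (hε ε hpos).2 k

theorem addHaar_image_eq_zero_of_lipschitzOnWith {E : Type*} [NormedAddCommGroup E]
    [NormedSpace ℝ E] [FiniteDimensional ℝ E] [MeasurableSpace E] [BorelSpace E] (μ : Measure E)
    [μ.IsAddHaarMeasure] {K : NNReal} {f : E → E} {s : Set E} (hf : LipschitzOnWith K f s)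
    (hs : μ s = 0) : μ (f '' s) = 0 := by
  have himage := hf.hausdorffMeasure_image_le (d := Module.finrank ℝ E) (by positivity)
  rw [Measure.absolutelyContinuous_isAddHaarMeasure _ μ hs, mul_zero] at himage
  exact Measure.absolutelyContinuous_isAddHaarMeasure μ _ (le_antisymm himage zero_le)

theorem ae_hasFDerivAt_gradient_legendre (hF : StrongConvexOn Ω m F) (hm : 0 < m)
    (hΩ : IsOpen Ω) : ∀ᵐ x, x ∈ Ω → ∃ y ∈ subdifferential Ω F x, ∃ T : 𝔼 →L[ℝ] 𝔼,
      HasFDerivAt (gradient (legendre Ω F)) T y ∧ T.det ≠ 0 := by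
  set X := gradient (legendre Ω F)
  set D := subgradientImage Ω F
  have hLip : LipschitzOnWith (m⁻¹).toNNReal X D := lipschitzOnWith_gradient_legendre hF hm hΩ
  have hrademacher : volume (X '' {y ∈ D | ¬ DifferentiableAt ℝ X y}) = 0 := by
    refine addHaar_image_eq_zero_of_lipschitzOnWith volume (hLip.mono (sep_subset D _))
      (measure_mono_null ?_ (ae_iff.mp (hLip.ae_differentiableWithinAt_of_mem (μ := volume))))
    exact fun y hy hdiff => hy.2
      ((hdiff hy.1).differentiableAt ((isOpen_subgradientImage hF hm hΩ).mem_nhds hy.1))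
  have hsard : volume (X '' {y ∈ D | DifferentiableAt ℝ X y ∧ (fderiv ℝ X y).det = 0}) = 0 :=
    addHaar_image_eq_zero_of_det_fderivWithin_eq_zero volume (f' := fderiv ℝ X)
      (fun y hy => hy.2.1.hasFDerivAt.hasFDerivWithinAt) fun y hy => hy.2.2
  filter_upwards [compl_mem_ae_iff.mpr hrademacher, compl_mem_ae_iff.mpr hsard] with x hreg hcrit hx
  obtain ⟨y, hy⟩ := exists_mem_subdifferential hΩ (hF.convexOn fun t => by positivity) hx
  have hyD : y ∈ D := mem_subgradientImage.mpr ⟨x, hx, hy⟩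
  have hXy : X y = x := (hasGradientAt_legendre hF hm hΩ hx hy).gradient
  have hdiff : DifferentiableAt ℝ X y := by_contra fun hnot => hreg ⟨y, ⟨hyD, hnot⟩, hXy⟩
  exact ⟨y, hy, fderiv ℝ X y, hdiff.hasFDerivAt, fun hdet => hcrit ⟨y, ⟨hyD, hdiff, hdet⟩, hXy⟩⟩

theorem ne_zero_of_diagForm_eq_inner_map {e : OrthonormalBasis (Fin n) ℝ 𝔼} {d : Fin n → ℝ}
    {T : 𝔼 →L[ℝ] 𝔼} (hT : T.det ≠ 0) (heq : ∀ h k, ⟪T h, k⟫ = diagForm e d h k) (i : Fin n) :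
    d i ≠ 0 := by
  intro hdi
  have hTe : T (e i) = 0 := by
    refine ext_inner_right ℝ fun k => ?_
    simp [heq, diagForm_apply, e.inner_eq_ite, hdi]
  have hinj : Function.Injective (T : 𝔼 →ₗ[ℝ] 𝔼) := (LinearMap.equivOfDetNeZero _ hT).injective
  exact e.orthonormal.ne_zero i (hinj (hTe.trans (map_zero T).symm))

theorem exists_hasSecondOrderExpansion_of_strongConvexOn (hF : StrongConvexOn Ω m F) (hm : 0 < m)
    (hΩ : IsOpen Ω) (hx : x ∈ Ω) (hy : y ∈ subdifferential Ω F x) {T : 𝔼 →L[ℝ] 𝔼}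
    (hT : HasFDerivAt (gradient (legendre Ω F)) T y) (hdet : T.det ≠ 0) :
    ∃ b, HasSecondOrderExpansion F x y b := by
  have hD : subgradientImage Ω F ∈ 𝓝 y :=
    (isOpen_subgradientImage hF hm hΩ).mem_nhds (mem_subgradientImage.mpr ⟨x, hx, hy⟩)
  have hfirst : ∀ᶠ z in 𝓝 y, HasFDerivAt (legendre Ω F)
      (innerSL ℝ (gradient (legendre Ω F) z)) z := by
    filter_upwards [hD] with z hz
    obtain ⟨w, hw, hwz⟩ := mem_subgradientImage.mp hz
    exact (hasGradientAt_legendre hF hm hΩ hw hwz).differentiableAt.hasGradientAt.hasFDerivAt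
  have hexp := hasSecondOrderExpansion_of_hasFDerivAt hfirst
    ((innerSL ℝ : 𝔼 →L[ℝ] 𝔼 →L[ℝ] ℝ).hasFDerivAt.comp y hT)
  obtain ⟨hslope, hnonneg⟩ := (isLowerParaboloid_zero_of_mem_subdifferential hD
    (mem_subdifferential_legendre hx hy)).eq_and_le_of_hasSecondOrderExpansion hexp
  obtain ⟨e, d, hed⟩ := hexp.symm.exists_eq_diagForm
  rw [← hslope, hed] at hexp
  have hdpos (i : Fin n) : 0 < d i := by
    refine lt_of_le_of_ne ?_ (ne_zero_of_diagForm_eq_inner_map (e := e) hdet (fun h k => ?_) i).symm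
    · simpa [hed, diagForm_basis] using hnonneg (e i)
    · exact DFunLike.congr_fun (DFunLike.congr_fun hed h) k
  exact ⟨_, hasSecondOrderExpansion_of_legendre hΩ (hF.convexOn fun t => by positivity) hD hx hy e
    hdpos hexp⟩

theorem ae_exists_hasSecondOrderExpansion (hu : ConvexOn ℝ Ω u) (hΩ : IsOpen Ω) :
    ∀ᵐ x, x ∈ Ω → ∃ p ∈ subdifferential Ω u x, ∃ b, HasSecondOrderExpansion u x p b := by
  have hF := strongConvexOn_mul_add_sq hu zero_le_one 1
  filter_upwards [ae_hasFDerivAt_gradient_legendre hF one_pos hΩ] with x hx hxΩ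
  obtain ⟨y, hy, T, hT, hdet⟩ := hx hxΩ
  obtain ⟨b, hb⟩ := exists_hasSecondOrderExpansion_of_strongConvexOn hF one_pos hΩ hxΩ hy hT hdet
  have hsub := mem_subdifferential_of_mul_add_sq hu one_pos hxΩ hy
  rw [inv_one, one_smul, one_smul] at hsub
  have hexp := hb.mul_add_sq one_pos (-1)
  have hu_eq : (fun z => 1 * (1 * u z + 1 / 2 * ‖z‖ ^ 2) + -1 / 2 * ‖z‖ ^ 2) = u := by
    ext z
    ring
  rw [hu_eq, one_smul, one_smul, neg_one_smul, ← sub_eq_add_neg] at hexp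
  exact ⟨y - x, hsub, _, hexp⟩

end Alexandrov

section SecondDifferences

variable {E : Type*} [NormedAddCommGroup E] [NormedSpace ℝ E] {f : E → ℝ} {x : E}

/-- The symmetric second difference quotient of `f` at `x` in direction `e` with step `t`. -/
def secondDiff (f : E → ℝ) (e : E) (t : ℝ) (x : E) : ℝ :=
  (t ^ 2)⁻¹ * (f (x + t • e) + f (x + -t • e) - 2 * f x)

theorem continuous_secondDiff (hf : Continuous f) (e : E) (t : ℝ) :
    Continuous (secondDiff f e t) := by
  unfold secondDiff
  fun_prop

theorem secondDiff_nonneg {Ω : Set E} (hf : ConvexOn ℝ Ω f) {e : E} {t : ℝ}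
    (h₁ : x + t • e ∈ Ω) (h₂ : x + -t • e ∈ Ω) : 0 ≤ secondDiff f e t x := by
  have h := hf.2 h₁ h₂ (by norm_num : (0 : ℝ) ≤ 1 / 2) (by norm_num : (0 : ℝ) ≤ 1 / 2) (by norm_num)
  have hx : (1 / 2 : ℝ) • (x + t • e) + (1 / 2 : ℝ) • (x + -t • e) = x := by module
  rw [hx, smul_eq_mul, smul_eq_mul] at h
  exact mul_nonneg (by positivity) (by linarith)

theorem tendsto_mul_smul_punctured_nhds_zero (e : E) (a : ℝ) :
    Tendsto (fun t : ℝ => (a * t) • e) (𝓝[≠] 0) (𝓝 0) := by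
  have hc : Continuous fun t : ℝ => (a * t) • e := by fun_prop
  have h := hc.tendsto 0
  rw [mul_zero, zero_smul] at h
  exact h.mono_left nhdsWithin_le_nhds

theorem eventually_add_smul_mem_ball {r : ℝ} (hr : 0 < r) (R : ℝ) (x e : E) (a : ℝ) :
    ∀ᶠ t in 𝓝[≠] (0 : ℝ), ∀ y ∈ ball x R, y + (a * t) • e ∈ ball x (R + r) := by
  filter_upwards [(tendsto_mul_smul_punctured_nhds_zero e a).eventually (ball_mem_nhds 0 hr)]
    with t ht y hy
  rw [dist_zero_right] at ht
  calc dist (y + (a * t) • e) x ≤ dist (y + (a * t) • e) y + dist y x := dist_triangle _ _ _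
    _ = ‖(a * t) • e‖ + dist y x := by rw [dist_eq_norm, add_sub_cancel_left]
    _ < R + r := by linarith [mem_ball.mp hy]

end SecondDifferences

section SecondDifferenceLimits

variable {E : Type*} [NormedAddCommGroup E] [InnerProductSpace ℝ E] {f : E → ℝ} {x p : E}
  {a : E →L[ℝ] E →L[ℝ] ℝ}

theorem IsLowerParaboloid.eventually_le_secondDiff (h : IsLowerParaboloid f x p a) (e : E) :
    ∀ᶠ t in 𝓝[≠] (0 : ℝ), a e e ≤ secondDiff f e t x := by
  filter_upwards [(tendsto_mul_smul_punctured_nhds_zero e 1).eventually h,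
    (tendsto_mul_smul_punctured_nhds_zero e (-1)).eventually h, self_mem_nhdsWithin]
    with t h₁ h₂ ht
  have ht : 0 < t ^ 2 := sq_pos_of_ne_zero ht
  simp only [one_mul, neg_one_mul, inner_smul_right, map_smul, smul_apply, smul_eq_mul] at h₁ h₂
  rw [secondDiff, le_inv_mul_iff₀ ht]
  linarith

theorem IsUpperParaboloid.eventually_secondDiff_le (h : IsUpperParaboloid f x p a) (e : E) :
    ∀ᶠ t in 𝓝[≠] (0 : ℝ), secondDiff f e t x ≤ a e e := by
  filter_upwards [(tendsto_mul_smul_punctured_nhds_zero e 1).eventually h,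
    (tendsto_mul_smul_punctured_nhds_zero e (-1)).eventually h, self_mem_nhdsWithin]
    with t h₁ h₂ ht
  have ht : 0 < t ^ 2 := sq_pos_of_ne_zero ht
  simp only [one_mul, neg_one_mul, inner_smul_right, map_smul, smul_apply, smul_eq_mul] at h₁ h₂
  rw [secondDiff, inv_mul_le_iff₀ ht]
  linarith

theorem HasSecondOrderExpansion.tendsto_secondDiff (h : HasSecondOrderExpansion f x p a) (e : E) :
    Tendsto (fun t => secondDiff f e t x) (𝓝[≠] 0) (𝓝 (a e e)) := by
  rw [Metric.tendsto_nhds]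
  intro ε hε
  obtain ⟨η, hη, hηε⟩ := exists_pos_mul_lt hε (‖e‖ ^ 2)
  filter_upwards [(h.lower η hη).eventually_le_secondDiff e,
    (h.upper η hη).eventually_secondDiff_le e] with t h₁ h₂
  simp only [sub_apply, add_apply, smul_apply, innerForm_self, smul_eq_mul] at h₁ h₂
  rw [Real.dist_eq, abs_lt]
  constructor <;> linarith

theorem HasSecondOrderExpansion.congr (h : HasSecondOrderExpansion f x p a) {g : E → ℝ}
    (hfg : f =ᶠ[𝓝 x] g) : HasSecondOrderExpansion g x p a := by
  have hfg' := (tendsto_const_add_nhds_zero x).eventually hfg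
  refine ⟨h.symm, fun ε hε => ?_, fun ε hε => ?_⟩
  · filter_upwards [h.lower ε hε, hfg'] with k hk hk'
    rwa [← hk', ← hfg.self_of_nhds]
  · filter_upwards [h.upper ε hε, hfg'] with k hk hk'
    rwa [← hk', ← hfg.self_of_nhds]

theorem nonneg_of_hasSecondOrderExpansion {Ω : Set E} (hΩ : Ω ∈ 𝓝 x) (hf : ConvexOn ℝ Ω f)
    (hexp : HasSecondOrderExpansion f x p a) (e : E) : 0 ≤ a e e := by
  have hmem : ∀ r : ℝ, ∀ᶠ t in 𝓝[≠] (0 : ℝ), x + (r * t) • e ∈ Ω := fun r =>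
    ((tendsto_const_add_nhds_zero x).comp (tendsto_mul_smul_punctured_nhds_zero e r)).eventually hΩ
  refine ge_of_tendsto (hexp.tendsto_secondDiff e) ?_
  filter_upwards [hmem 1, hmem (-1)] with t h₁ h₂
  rw [one_mul] at h₁
  rw [neg_one_mul] at h₂
  exact secondDiff_nonneg hf h₁ h₂

theorem tendsto_backward_difference [CompleteSpace E] (hf : HasGradientAt f p x) (ξ : E) :
    Tendsto (fun t : ℝ => t⁻¹ * (f x - f (x + -t • ξ))) (𝓝[>] 0) (𝓝 ⟪ξ, p⟫) := by
  have h := (hf.hasFDerivAt.hasLineDerivAt (-ξ)).tendsto_slope_zero_right.neg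
  rw [InnerProductSpace.toDual_apply_apply, inner_neg_right, neg_neg, real_inner_comm] at h
  refine h.congr fun t => ?_
  rw [smul_eq_mul, ← mul_neg, neg_sub, smul_neg, neg_smul]

end SecondDifferenceLimits

theorem integral_le_of_tendsto_integral {α ι : Type*} [MeasurableSpace α] {μ : Measure α}
    {l : Filter ι} [l.NeBot] [l.IsCountablyGenerated] {f : ι → α → ℝ} {h : α → ℝ} {I : ℝ}
    (hf0 : ∀ᶠ i in l, 0 ≤ᵐ[μ] f i) (hfi : ∀ i, Integrable (f i) μ) (hh : Integrable h μ)
    (hlim : ∀ᵐ z ∂μ, ∃ a, Tendsto (fun i => f i z) l (𝓝 a) ∧ h z ≤ a)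
    (hI : Tendsto (fun i => ∫ z, f i z ∂μ) l (𝓝 I)) : ∫ z, h z ∂μ ≤ I := by
  have hI0 : 0 ≤ I := ge_of_tendsto hI (hf0.mono fun i hi => integral_nonneg_of_ae hi)
  have hfatou : ∫⁻ z, ENNReal.ofReal (h z) ∂μ ≤ ENNReal.ofReal I := by
    calc ∫⁻ z, ENNReal.ofReal (h z) ∂μ
        ≤ ∫⁻ z, liminf (fun i => ENNReal.ofReal (f i z)) l ∂μ := by
          refine lintegral_mono_ae ?_
          filter_upwards [hlim] with z ⟨a, ha, hle⟩
          rw [(ENNReal.tendsto_ofReal ha).liminf_eq]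
          exact ENNReal.ofReal_le_ofReal hle
      _ ≤ liminf (fun i => ∫⁻ z, ENNReal.ofReal (f i z) ∂μ) l :=
          lintegral_liminf_le' fun i => (hfi i).aemeasurable.ennreal_ofReal
      _ = liminf (fun i => ENNReal.ofReal (∫ z, f i z ∂μ)) l :=
          liminf_congr (hf0.mono fun i hi => (ofReal_integral_eq_lintegral_ofReal (hfi i) hi).symm)
      _ = ENNReal.ofReal I := (ENNReal.tendsto_ofReal hI).liminf_eq
  calc ∫ z, h z ∂μ ≤ ∫ z, max (h z) 0 ∂μ :=
        integral_mono hh hh.pos_part fun z => le_max_left _ _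
    _ = (∫⁻ z, ENNReal.ofReal (max (h z) 0) ∂μ).toReal :=
        integral_eq_lintegral_of_nonneg_ae (ae_of_all _ fun z => le_max_right _ _)
          hh.pos_part.aestronglyMeasurable
    _ = (∫⁻ z, ENNReal.ofReal (h z) ∂μ).toReal := by simp [ENNReal.ofReal_max]
    _ ≤ (ENNReal.ofReal I).toReal := ENNReal.toReal_mono ENNReal.ofReal_ne_top hfatou
    _ = I := ENNReal.toReal_ofReal hI0

section Mollification

variable {E : Type*} [NormedAddCommGroup E] [InnerProductSpace ℝ E] [FiniteDimensional ℝ E]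
  [MeasurableSpace E] [BorelSpace E] (φ : ContDiffBump (0 : E)) {f g : E → ℝ}

/-- The mollification of `g`: its convolution with the normalized bump function `φ`. -/
def mollify (φ : ContDiffBump (0 : E)) (g : E → ℝ) (x : E) : ℝ :=
  ∫ z, φ.normed volume z * g (x - z)

theorem mollify_eq_convolution (g : E → ℝ) :
    mollify φ g = convolution (φ.normed volume) g (ContinuousLinearMap.lsmul ℝ ℝ) volume := rfl

theorem contDiff_mollify (hg : Continuous g) : ContDiff ℝ 2 (mollify φ g) := by
  rw [mollify_eq_convolution]
  exact φ.hasCompactSupport_normed.contDiff_convolution_left _ φ.contDiff_normed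
    hg.locallyIntegrable

theorem abs_mollify_sub_le (hg : Continuous g) {x : E} {δ : ℝ}
    (h : ∀ y ∈ ball x φ.rOut, dist (g y) (g x) ≤ δ) : |mollify φ g x - g x| ≤ δ := by
  rw [mollify_eq_convolution]
  exact φ.dist_normed_convolution_le hg.aestronglyMeasurable h

theorem integrable_normed_mul (hf : Continuous f) (x : E) :
    Integrable fun z => φ.normed volume z * f (x - z) :=
  (φ.continuous_normed.mul (by fun_prop)).integrable_of_hasCompactSupport
    φ.hasCompactSupport_normed.mul_right

theorem normed_eq_zero_of_sub_notMem_ball {x z : E} (hz : x - z ∉ ball x φ.rOut) :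
    φ.normed volume z = 0 := by
  refine Function.notMem_support.mp fun h => hz ?_
  rw [φ.support_normed_eq, mem_ball_zero_iff] at h
  rwa [mem_ball, dist_eq_norm, sub_sub_cancel_left, norm_neg]

theorem mollify_const (L : ℝ) (x : E) : mollify φ (fun _ => L) x = L := by
  rw [mollify, integral_mul_const, φ.integral_normed, one_mul]

theorem mollify_const_mul (g : E → ℝ) (a : ℝ) (x : E) :
    mollify φ (fun y => a * g y) x = a * mollify φ g x := by
  simp only [mollify, ← integral_const_mul, mul_left_comm]

theorem mollify_add (hf : Continuous f) (hg : Continuous g) (x : E) :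
    mollify φ (fun y => f y + g y) x = mollify φ f x + mollify φ g x := by
  simp only [mollify, mul_add]
  exact integral_add (integrable_normed_mul φ hf x) (integrable_normed_mul φ hg x)

theorem mollify_sub (hf : Continuous f) (hg : Continuous g) (x : E) :
    mollify φ (fun y => f y - g y) x = mollify φ f x - mollify φ g x := by
  simp only [mollify, mul_sub]
  exact integral_sub (integrable_normed_mul φ hf x) (integrable_normed_mul φ hg x)

theorem mollify_finsetSum {ι : Type*} (s : Finset ι) {f : ι → E → ℝ} (hf : ∀ i, Continuous (f i))
    (x : E) : mollify φ (fun y => ∑ i ∈ s, f i y) x = ∑ i ∈ s, mollify φ (f i) x := by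
  simp only [mollify, Finset.mul_sum]
  exact integral_finsetSum s fun i _ => integrable_normed_mul φ (hf i) x

theorem mollify_comp_add_right (g : E → ℝ) (a x : E) :
    mollify φ (fun y => g (y + a)) x = mollify φ g (x + a) := by
  simp only [mollify, sub_add_eq_add_sub]

theorem mollify_mono (hf : Continuous f) (hg : Continuous g) {x : E}
    (h : ∀ y ∈ ball x φ.rOut, f y ≤ g y) : mollify φ f x ≤ mollify φ g x := by
  refine integral_mono (integrable_normed_mul φ hf x) (integrable_normed_mul φ hg x) fun z => ?_
  by_cases hz : x - z ∈ ball x φ.rOut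
  · exact mul_le_mul_of_nonneg_left (h _ hz) (φ.nonneg_normed z)
  · simp only [normed_eq_zero_of_sub_notMem_ball φ hz, zero_mul, le_refl]

theorem mollify_le_of_tendsto {ι : Type*} {l : Filter ι} [l.NeBot] [l.IsCountablyGenerated]
    {x : E} {I : ℝ} {G : ι → E → ℝ} (hGc : ∀ i, Continuous (G i))
    (hG0 : ∀ᶠ i in l, ∀ y ∈ ball x φ.rOut, 0 ≤ G i y) (hf : Continuous f)
    (hlim : ∀ᵐ y, y ∈ ball x φ.rOut → ∃ a, Tendsto (fun i => G i y) l (𝓝 a) ∧ f y ≤ a)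
    (hI : Tendsto (fun i => mollify φ (G i) x) l (𝓝 I)) : mollify φ f x ≤ I := by
  refine integral_le_of_tendsto_integral ?_ (fun i => integrable_normed_mul φ (hGc i) x)
    (integrable_normed_mul φ hf x) ?_ hI
  · filter_upwards [hG0] with i hi
    refine ae_of_all _ fun z => ?_
    by_cases hz : x - z ∈ ball x φ.rOut
    · exact mul_nonneg (φ.nonneg_normed z) (hi _ hz)
    · simp only [normed_eq_zero_of_sub_notMem_ball φ hz, zero_mul, Pi.zero_apply, le_refl]
  · filter_upwards [(Measure.measurePreserving_sub_left volume x).quasiMeasurePreserving.ae hlim]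
      with z hz
    by_cases hzb : x - z ∈ ball x φ.rOut
    · obtain ⟨a, ha, hle⟩ := hz hzb
      exact ⟨φ.normed volume z * a, ha.const_mul _,
        mul_le_mul_of_nonneg_left hle (φ.nonneg_normed z)⟩
    · simp only [normed_eq_zero_of_sub_notMem_ball φ hzb, zero_mul]
      exact ⟨0, tendsto_const_nhds, le_rfl⟩

theorem convexOn_mollify {Ω K : Set E} (hg : ConvexOn ℝ Ω g) (hgc : Continuous g)
    (hK : Convex ℝ K) (hKΩ : ∀ x ∈ K, ball x φ.rOut ⊆ Ω) : ConvexOn ℝ K (mollify φ g) := by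
  refine ⟨hK, fun x hx y hy a b ha hb hab => ?_⟩
  have hmem : ∀ x' ∈ K, ∀ w ∈ ball (0 : E) φ.rOut, w + x' ∈ Ω := fun x' hx' w hw =>
    hKΩ x' hx' (by rwa [mem_ball, dist_eq_norm, add_sub_cancel_right, ← mem_ball_zero_iff])
  have hmono : mollify φ (fun w => g (w + (a • x + b • y))) 0 ≤
      mollify φ (fun w => a * g (w + x) + b * g (w + y)) 0 := by
    refine mollify_mono φ (by fun_prop) (by fun_prop) fun w hw => ?_
    have h := hg.2 (hmem x hx w hw) (hmem y hy w hw) ha hb hab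
    rwa [smul_add, smul_add, add_add_add_comm, ← add_smul, hab, one_smul] at h
  rw [mollify_add φ (by fun_prop) (by fun_prop)] at hmono
  simpa only [mollify_const_mul, mollify_comp_add_right, zero_add, smul_eq_mul] using hmono

theorem secondDiff_mollify (hg : Continuous g) (e : E) (t : ℝ) (x : E) :
    mollify φ (secondDiff g e t) x = secondDiff (mollify φ g) e t x := by
  unfold secondDiff
  rw [mollify_const_mul, mollify_sub φ (by fun_prop) (by fun_prop),
    mollify_add φ (by fun_prop) (by fun_prop), mollify_const_mul, mollify_comp_add_right,
    mollify_comp_add_right]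

/- The singular part of the Hessian of a convex function is nonnegative, so passing from second
differences to the absolutely continuous part only loses mass in the limit. -/
theorem mollify_le_sum_of_hasSecondOrderExpansion {Ω : Set E} (hg : ConvexOn ℝ Ω g)
    (hgc : Continuous g) (hf : Continuous f) {ι : Type*} [Fintype ι] {w : ι → ℝ}
    (hw : ∀ j, 0 ≤ w j) {e : ι → E} {x q : E} {B : E →L[ℝ] E →L[ℝ] ℝ} {r : ℝ} (hr : 0 < r)
    (hball : ball x (φ.rOut + r) ⊆ Ω)
    (hae : ∀ᵐ y, y ∈ ball x φ.rOut → ∃ p b, HasSecondOrderExpansion g y p b ∧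
      f y ≤ ∑ j, w j * b (e j) (e j))
    (hB : HasSecondOrderExpansion (mollify φ g) x q B) :
    mollify φ f x ≤ ∑ j, w j * B (e j) (e j) := by
  refine mollify_le_of_tendsto φ (l := 𝓝[≠] (0 : ℝ))
    (G := fun t y => ∑ j, w j * secondDiff g (e j) t y)
    (fun t => continuous_finsetSum _ fun j _ => (continuous_secondDiff hgc (e j) t).const_mul _)
    ?_ hf ?_ ?_
  · filter_upwards [eventually_all.2 fun j => eventually_add_smul_mem_ball hr φ.rOut x (e j) 1,
      eventually_all.2 fun j => eventually_add_smul_mem_ball hr φ.rOut x (e j) (-1)]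
      with t h₁ h₂ y hy
    simp only [one_mul] at h₁
    simp only [neg_one_mul] at h₂
    exact Finset.sum_nonneg fun j _ => mul_nonneg (hw j)
      (secondDiff_nonneg hg (hball (h₁ j y hy)) (hball (h₂ j y hy)))
  · filter_upwards [hae] with y hy hyb
    obtain ⟨p, b, hb, hle⟩ := hy hyb
    exact ⟨_, tendsto_finsetSum _ fun j _ => (hb.tendsto_secondDiff (e j)).const_mul _, hle⟩
  · simp only [mollify_finsetSum φ _ fun j => (continuous_secondDiff hgc (e j) _).const_mul _,
      mollify_const_mul, secondDiff_mollify φ hgc]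
    exact tendsto_finsetSum _ fun j _ => (hB.tendsto_secondDiff (e j)).const_mul _

end Mollification

section MollifiedSubsolutions

variable {n : ℕ}

local notation "𝔼" => EuclideanSpace ℝ (Fin n)

variable {Ω : Set (EuclideanSpace ℝ (Fin n))} {g u : EuclideanSpace ℝ (Fin n) → ℝ}
  {x ξ : EuclideanSpace ℝ (Fin n)} {L r : ℝ}

/-- `g` satisfies `∑ arctan λᵢ(D²g) ≥ L + ξ · Dg` almost everywhere on `Ω`, where the gradient and
the Hessian are those of a second-order expansion of `g`, and the gradient is a subgradient. -/
def IsAESubsolution (Ω : Set 𝔼) (L : ℝ) (ξ : 𝔼) (g : 𝔼 → ℝ) : Prop :=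
  ∀ᵐ y, y ∈ Ω → ∃ p ∈ subdifferential Ω g y, ∃ b, HasSecondOrderExpansion g y p b ∧
    L + ⟪ξ, p⟫ ≤ formPhase b

theorem add_inner_gradient_mollify_le {φ : ContDiffBump (0 : 𝔼)} (hg : ConvexOn ℝ Ω g)
    (hgc : Continuous g) {ι : Type*} [Fintype ι] {w : ι → ℝ} (hw : ∀ j, 0 ≤ w j) {e : ι → 𝔼}
    (hr : 0 < r) (hball : ball x (φ.rOut + r) ⊆ Ω)
    (hae : ∀ᵐ y, y ∈ Ω → ∃ p ∈ subdifferential Ω g y, ∃ b,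
      HasSecondOrderExpansion g y p b ∧ L + ⟪ξ, p⟫ ≤ ∑ j, w j * b (e j) (e j)) :
    L + ⟪ξ, gradient (mollify φ g) x⟫ ≤
      ∑ j, w j * fderiv ℝ (fderiv ℝ (mollify φ g)) x (e j) (e j) := by
  have hv : ContDiffAt ℝ 2 (mollify φ g) x := (contDiff_mollify φ hgc).contDiffAt
  refine le_of_tendsto (tendsto_const_nhds.add
    (tendsto_backward_difference (hv.differentiableAt two_ne_zero).hasGradientAt ξ)) ?_
  filter_upwards [nhdsGT_le_nhdsNE (0 : ℝ) (eventually_add_smul_mem_ball hr φ.rOut x ξ (-1)),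
    self_mem_nhdsWithin] with t ht (ht0 : 0 < t)
  simp only [neg_one_mul] at ht
  -- The gradient enters linearly, so it may be replaced by a difference quotient of `g`.
  have hquot : mollify φ (fun y => L + t⁻¹ * (g y - g (y + -t • ξ))) x =
      L + t⁻¹ * (mollify φ g x - mollify φ g (x + -t • ξ)) := by
    rw [mollify_add φ (by fun_prop) (by fun_prop), mollify_const, mollify_const_mul,
      mollify_sub φ (by fun_prop) (by fun_prop), mollify_comp_add_right]
  rw [← hquot]
  refine mollify_le_sum_of_hasSecondOrderExpansion φ hg hgc (by fun_prop) hw hr hball ?_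
    (hasSecondOrderExpansion_of_contDiffAt hv)
  filter_upwards [hae] with y hy hyb
  obtain ⟨p, hp, b, hb, hle⟩ := hy (hball (ball_subset_ball (by linarith) hyb))
  refine ⟨p, b, hb, le_trans (add_le_add_right ?_ L) hle⟩
  have hsub := hp _ (hball (ht y hyb))
  rw [add_sub_cancel_left, inner_smul_right, real_inner_comm] at hsub
  rw [inv_mul_le_iff₀ ht0]
  linarith

theorem IsAESubsolution.le_formPhase_mollify {φ : ContDiffBump (0 : 𝔼)}
    (hae : IsAESubsolution Ω L ξ g) (hΩ : IsOpen Ω) (hg : ConvexOn ℝ Ω g) (hgc : Continuous g)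
    (hr : 0 < r) (hball : ball x (φ.rOut + r) ⊆ Ω) :
    L + ⟪ξ, gradient (mollify φ g) x⟫ ≤ formPhase (fderiv ℝ (fderiv ℝ (mollify φ g)) x) := by
  have hexp := hasSecondOrderExpansion_of_contDiffAt
    (contDiff_mollify φ hgc).contDiffAt (x := x)
  have hconv : ConvexOn ℝ (ball x r) (mollify φ g) := by
    refine convexOn_mollify φ hg hgc (convex_ball x r) fun x' hx' => ?_
    exact (ball_subset_ball' (by linarith [mem_ball.mp hx'])).trans hball
  have hB0 := nonneg_of_hasSecondOrderExpansion (ball_mem_nhds x hr) hconv hexp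
  obtain ⟨e, μ, hB⟩ := hexp.symm.exists_eq_diagForm
  have hμ : ∀ j, 0 ≤ μ j := fun j => by simpa only [hB, diagForm_basis] using hB0 (e j)
  -- Linearize the phase, concave on nonnegative forms, at the Hessian of the mollification.
  have hlin : ∀ᵐ y, y ∈ Ω → ∃ p ∈ subdifferential Ω g y, ∃ b, HasSecondOrderExpansion g y p b ∧
      L - ∑ j, (Real.arctan (μ j) - (1 + μ j ^ 2)⁻¹ * μ j) + ⟪ξ, p⟫ ≤
        ∑ j, (1 + μ j ^ 2)⁻¹ * b (e j) (e j) := by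
    filter_upwards [hae] with y hy hyΩ
    obtain ⟨p, hp, b, hb, hle⟩ := hy hyΩ
    refine ⟨p, hp, b, hb, ?_⟩
    have h := formPhase_le_linearization hb.symm
      (nonneg_of_hasSecondOrderExpansion (hΩ.mem_nhds hyΩ) hg hb) e hμ
    simp only [mul_sub, Finset.sum_add_distrib, Finset.sum_sub_distrib] at h ⊢
    linarith
  have h := add_inner_gradient_mollify_le hg hgc (fun j => by positivity) hr hball hlin
  rw [hB] at h ⊢
  simp only [diagForm_basis, formPhase_diagForm, Finset.sum_sub_distrib] at h ⊢
  linarith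

theorem IsAESubsolution.exists_contDiff_approx {x₀ : 𝔼}
    (hae : IsAESubsolution (ball x₀ (3 * r)) L ξ u) (hu : ConvexOn ℝ (ball x₀ (3 * r)) u)
    (hcont : ContinuousOn u (closedBall x₀ (3 * r))) (hr : 0 < r) {σ : ℝ} (hσ : 0 < σ) :
    ∃ v : 𝔼 → ℝ, ContDiff ℝ 2 v ∧ ConvexOn ℝ (closedBall x₀ r) v ∧
      ∀ x ∈ closedBall x₀ r, |v x - u x| ≤ σ ∧
        L + ⟪ξ, gradient v x⟫ ≤ formPhase (fderiv ℝ (fderiv ℝ v) x) := by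
  obtain ⟨g, hg⟩ := ContinuousMap.exists_restrict_eq (isClosed_closedBall (x := x₀) (ε := 3 * r))
    ⟨_, hcont.domRestrict⟩
  have hgu : EqOn g u (closedBall x₀ (3 * r)) := fun x hx =>
    congrArg (fun f : C(closedBall x₀ (3 * r), ℝ) => f ⟨x, hx⟩) hg
  have hgu' : EqOn g u (ball x₀ (3 * r)) := hgu.mono ball_subset_closedBall
  have hgconv : ConvexOn ℝ (ball x₀ (3 * r)) g := hu.congr hgu'.symm
  have hgae : IsAESubsolution (ball x₀ (3 * r)) L ξ g := by
    filter_upwards [hae] with y hy hyb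
    obtain ⟨p, hp, b, hb, hle⟩ := hy hyb
    refine ⟨p, fun z hz => ?_, b, hb.congr ?_, hle⟩
    · rw [hgu' hyb, hgu' hz]
      exact hp z hz
    · exact (hgu'.eventuallyEq_of_mem (isOpen_ball.mem_nhds hyb)).symm
  obtain ⟨δ, hδ, hunif⟩ := Metric.uniformContinuousOn_iff.mp
    ((isCompact_closedBall x₀ (3 * r)).uniformContinuousOn_of_continuous
      g.continuous.continuousOn) σ hσ
  have hρ : 0 < min r δ := lt_min hr hδ
  set φ : ContDiffBump (0 : 𝔼) := ⟨min r δ / 2, min r δ, half_pos hρ, half_lt_self hρ⟩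
  have hφr : φ.rOut ≤ r := min_le_left _ _
  have hin : ∀ x ∈ closedBall x₀ r, ball x (φ.rOut + r) ⊆ ball x₀ (3 * r) := fun x hx =>
    ball_subset_ball' (by linarith [mem_closedBall.mp hx])
  have hin' : ∀ x ∈ closedBall x₀ r, ball x φ.rOut ⊆ ball x₀ (3 * r) := fun x hx =>
    (ball_subset_ball (by linarith)).trans (hin x hx)
  refine ⟨mollify φ g, contDiff_mollify φ g.continuous,
    convexOn_mollify φ hgconv g.continuous (convex_closedBall _ _) hin', fun x hx => ⟨?_, ?_⟩⟩
  · have hx3 : x ∈ closedBall x₀ (3 * r) := closedBall_subset_closedBall (by linarith) hx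
    rw [← hgu hx3]
    refine abs_mollify_sub_le φ g.continuous fun y hy => ?_
    exact (hunif y (ball_subset_closedBall (hin' x hx hy)) x hx3
      ((mem_ball.mp hy).trans_le (min_le_right _ _))).le
  · exact hgae.le_formPhase_mollify isOpen_ball hgconv g.continuous hr (hin x hx)

end MollifiedSubsolutions

section Stability

variable {E : Type*} [NormedAddCommGroup E] [InnerProductSpace ℝ E] {f g : E → ℝ} {y p : E}
  {a : E →L[ℝ] E →L[ℝ] ℝ}

theorem isLowerParaboloid_of_isLocalMin [CompleteSpace E] (ha : IsSymmForm a) {k₁ : E}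
    (hmin : IsLocalMin (fun k => f (y + k) - ⟪p, k⟫ - a k k / 2) k₁) :
    IsLowerParaboloid f (y + k₁) (p + (InnerProductSpace.toDual ℝ E).symm (a k₁)) a := by
  filter_upwards [(tendsto_const_add_nhds_zero k₁).eventually hmin] with k hk
  simp only [map_add, add_apply, inner_add_right, ha k k₁, ← add_assoc] at hk
  rw [inner_add_left, InnerProductSpace.toDual_symm_apply]
  linarith

theorem IsLowerParaboloid.exists_near [FiniteDimensional ℝ E] (ha : IsSymmForm a) {κ : ℝ}
    (hκ : 0 < κ) (h : IsLowerParaboloid g y p (a + κ • innerForm E)) {ρ : ℝ} (hρ : 0 < ρ) :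
    ∃ σ > 0, ∀ f : E → ℝ, ContinuousOn f (closedBall y ρ) →
      (∀ z ∈ closedBall y ρ, |f z - g z| ≤ σ) → ∃ z ∈ ball y ρ, ∃ q, IsLowerParaboloid f z q a := by
  obtain ⟨δ₀, hδ₀, htouch⟩ := Metric.eventually_nhds_iff_ball.mp h
  set δ := min δ₀ ρ / 2
  have hδ : 0 < δ := by positivity
  have hδδ₀ : δ < δ₀ := (half_lt_self (by positivity)).trans_le (min_le_left _ _)
  have hδρ : δ < ρ := (half_lt_self (by positivity)).trans_le (min_le_right _ _)
  refine ⟨κ * δ ^ 2 / 8, by positivity, fun f hf hfg => ?_⟩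
  have hmaps : ∀ k ∈ closedBall (0 : E) δ, y + k ∈ closedBall y ρ := fun k hk => by
    rw [mem_closedBall, dist_eq_norm, add_sub_cancel_left]
    exact (mem_closedBall_zero_iff.mp hk).trans hδρ.le
  obtain ⟨k₁, hk₁, hmin⟩ := (isCompact_closedBall (0 : E) δ).exists_isMinOn
    (f := fun k => f (y + k) - ⟪p, k⟫ - a k k / 2) ⟨0, mem_closedBall_self hδ.le⟩
    (((hf.comp (by fun_prop) hmaps).sub (by fun_prop)).sub (by fun_prop))
  have hk₁δ : ‖k₁‖ < δ := by
    have hcenter : f (y + k₁) - ⟪p, k₁⟫ - a k₁ k₁ / 2 ≤ f (y + 0) - ⟪p, 0⟫ - a 0 0 / 2 :=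
      hmin (mem_closedBall_self hδ.le)
    have hlow := htouch k₁ (mem_ball_zero_iff.mpr
      ((mem_closedBall_zero_iff.mp hk₁).trans_lt hδδ₀))
    simp only [add_zero, inner_zero_right, map_zero, sub_zero, zero_div] at hcenter
    simp only [add_apply, smul_apply, innerForm_self, smul_eq_mul] at hlow
    have hy := (abs_le.mp (hfg y (mem_closedBall_self hρ.le))).2
    have hyk := (abs_le.mp (hfg _ (hmaps k₁ hk₁))).1
    have hsq : κ * ‖k₁‖ ^ 2 < κ * δ ^ 2 := by
      have : 0 < κ * δ ^ 2 := by positivity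
      linarith
    exact lt_of_pow_lt_pow_left₀ 2 hδ.le (lt_of_mul_lt_mul_left hsq hκ.le)
  refine ⟨y + k₁, ?_, _, isLowerParaboloid_of_isLocalMin ha
    (hmin.isLocalMin (closedBall_mem_nhds_of_mem (mem_ball_zero_iff.mpr hk₁δ)))⟩
  rw [mem_ball, dist_eq_norm, add_sub_cancel_left]
  exact hk₁δ.trans hδρ

variable {n : ℕ}

local notation "𝔼" => EuclideanSpace ℝ (Fin n)

variable {Ω K : Set (EuclideanSpace ℝ (Fin n))} {F G : EuclideanSpace ℝ (Fin n) → ℝ}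
  {x₀ y₀ x₁ y₁ y : EuclideanSpace ℝ (Fin n)} {m r σ : ℝ}

theorem subgradientImage_eq_univ (hK : IsCompact K) (hne : K.Nonempty) (hG : ContinuousOn G K) :
    subgradientImage K G = univ :=
  eq_univ_of_forall fun y =>
    mem_subgradientImage.mpr (exists_mem_subdifferential_of_isCompact hK hne hG y)

theorem continuous_legendre (hK : IsCompact K) (hne : K.Nonempty) (hG : ContinuousOn G K) :
    Continuous (legendre K G) := by
  obtain ⟨M, hM⟩ := hK.isBounded.exists_norm_le
  refine (LipschitzWith.of_le_add_mul M.toNNReal fun y y' => ?_).continuous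
  obtain ⟨x, hx, hy⟩ := exists_mem_subdifferential_of_isCompact hK hne hG y
  have hy' := inner_le_add_legendre (subgradientImage_eq_univ hK hne hG ▸ mem_univ y') hx
  have hinner : ⟪x, y⟫ - ⟪x, y'⟫ ≤ M.toNNReal * dist y y' := by
    rw [← inner_sub_right, dist_eq_norm]
    refine (real_inner_le_norm x (y - y')).trans ?_
    gcongr
    exact (hM x hx).trans (Real.le_coe_toNNReal M)
  rw [legendre_eq_of_mem_subdifferential hx hy]
  linarith

theorem abs_legendre_sub_legendre_le (hF : StrongConvexOn Ω m F) (hm : 0 < m)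
    (hFc : ContinuousOn F Ω) (hr : 0 < r) (hball : closedBall x₀ r ⊆ Ω)
    (hy₀ : y₀ ∈ subdifferential Ω F x₀) (hy : ‖y - y₀‖ < m * r / 2)
    (hG : ContinuousOn G (closedBall x₀ r)) (hGF : ∀ x ∈ closedBall x₀ r, |G x - F x| ≤ σ) :
    |legendre (closedBall x₀ r) G y - legendre Ω F y| ≤ σ := by
  have hK : IsCompact (closedBall x₀ r) := isCompact_closedBall x₀ r
  have hne : (closedBall x₀ r).Nonempty := ⟨x₀, mem_closedBall_self hr.le⟩
  obtain ⟨x, hx, hxy⟩ := exists_mem_subdifferential_of_norm_lt hF hm hFc hr hball hy₀ hy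
  obtain ⟨x', hx', hxy'⟩ := exists_mem_subdifferential_of_isCompact hK hne hG y
  have hlow := inner_le_add_legendre (mem_subgradientImage.mpr ⟨x', hx', hxy'⟩) hx
  have hup := inner_le_add_legendre (mem_subgradientImage.mpr ⟨x, hball hx, hxy⟩) (hball hx')
  have hGFx := (abs_le.mp (hGF x hx)).2
  have hGFx' := (abs_le.mp (hGF x' hx')).1
  have heq := legendre_eq_of_mem_subdifferential (hball hx) hxy
  have heq' := legendre_eq_of_mem_subdifferential hx' hxy'
  rw [abs_le]
  constructor <;> linarith

theorem mul_norm_sub_sq_le_of_mem_subdifferential (hF : StrongConvexOn Ω m F) (hKΩ : K ⊆ Ω)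
    (hx₀ : x₀ ∈ K) (hy₀ : y₀ ∈ subdifferential Ω F x₀) (hGF : ∀ x ∈ K, |G x - F x| ≤ σ)
    (hx₁ : x₁ ∈ K) (hy₁ : y₁ ∈ subdifferential K G x₁) :
    m / 2 * ‖x₁ - x₀‖ ^ 2 ≤ ‖y₁ - y₀‖ * ‖x₁ - x₀‖ + 2 * σ := by
  have hF₁ := add_sq_le_of_mem_subdifferential hF (hKΩ hx₀) hy₀ (hKΩ hx₁)
  have hG₀ := hy₁ x₀ hx₀
  have hinner := real_inner_le_norm (y₁ - y₀) (x₁ - x₀)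
  have hGF₁ := (abs_le.mp (hGF x₁ hx₁)).1
  have hGF₀ := (abs_le.mp (hGF x₀ hx₀)).2
  rw [← neg_sub x₁ x₀, inner_neg_right] at hG₀
  rw [inner_sub_left] at hinner
  linarith

theorem exists_isLowerParaboloid_legendre_near (hF : StrongConvexOn Ω m F) (hm : 0 < m)
    (hFc : ContinuousOn F Ω) (hr : 0 < r) (hball : closedBall x₀ r ⊆ Ω)
    (hy₀ : y₀ ∈ subdifferential Ω F x₀) {a : 𝔼 →L[ℝ] 𝔼 →L[ℝ] ℝ} (ha : IsSymmForm a) {κ : ℝ}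
    (hκ : 0 < κ) (htouch : IsLowerParaboloid (legendre Ω F) y₀ x₀ (a + κ • innerForm 𝔼)) {ρ : ℝ}
    (hρ : 0 < ρ) :
    ∃ σ > 0, ∀ G : 𝔼 → ℝ, ContinuousOn G (closedBall x₀ r) →
      (∀ x ∈ closedBall x₀ r, |G x - F x| ≤ σ) →
      ∃ x₁ ∈ ball x₀ ρ ∩ closedBall x₀ r, ∃ y₁ ∈ ball y₀ ρ,
        y₁ ∈ subdifferential (closedBall x₀ r) G x₁ ∧
        ∃ q, IsLowerParaboloid (legendre (closedBall x₀ r) G) y₁ q a := by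
  have hK : IsCompact (closedBall x₀ r) := isCompact_closedBall x₀ r
  have hx₀ : x₀ ∈ closedBall x₀ r := mem_closedBall_self hr.le
  obtain ⟨t, ht, htρ⟩ := exists_pos_mul_lt (show 0 < m / 2 * ρ ^ 2 by positivity) (r + 2)
  set τ := min t (min ρ (m * r / 4))
  have hτ : 0 < τ := by positivity
  have hτρ : τ ≤ ρ := (min_le_right _ _).trans (min_le_left _ _)
  have hτr : τ ≤ m * r / 4 := (min_le_right _ _).trans (min_le_right _ _)
  obtain ⟨σ, hσ, hnear⟩ := htouch.exists_near ha hκ hτ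
  refine ⟨min σ t, by positivity, fun G hG hGF => ?_⟩
  obtain ⟨y₁, hy₁, q, hq⟩ := hnear (legendre (closedBall x₀ r) G)
    (continuous_legendre hK ⟨x₀, hx₀⟩ hG).continuousOn fun z hz => by
      refine abs_legendre_sub_legendre_le hF hm hFc hr hball hy₀ ?_ hG fun x hx =>
        (hGF x hx).trans (min_le_left _ _)
      rw [← dist_eq_norm]
      linarith [mem_closedBall.mp hz, mul_pos hm hr]
  obtain ⟨x₁, hx₁, hxy₁⟩ := exists_mem_subdifferential_of_isCompact hK ⟨x₀, hx₀⟩ hG y₁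
  refine ⟨x₁, ⟨?_, hx₁⟩, y₁, ball_subset_ball hτρ hy₁, hxy₁, q, hq⟩
  have hsq := mul_norm_sub_sq_le_of_mem_subdifferential hF hball hx₀ hy₀
    (fun x hx => (hGF x hx).trans (min_le_right σ t)) hx₁ hxy₁
  have hprod : ‖y₁ - y₀‖ * ‖x₁ - x₀‖ ≤ t * r := by
    rw [← dist_eq_norm, ← dist_eq_norm]
    exact mul_le_mul ((mem_ball.mp hy₁).le.trans (min_le_left _ _)) hx₁ dist_nonneg ht.le
  rw [mem_ball, dist_eq_norm]
  exact lt_of_pow_lt_pow_left₀ 2 hρ.le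
    (lt_of_mul_lt_mul_left (show m / 2 * ‖x₁ - x₀‖ ^ 2 < m / 2 * ρ ^ 2 by linarith) (by positivity))

end Stability

section Viscosity

section Paraboloid

variable {E : Type*} [NormedAddCommGroup E] [InnerProductSpace ℝ E] {f φ : E → ℝ} {x p : E}
  {b : E →L[ℝ] E →L[ℝ] ℝ}

theorem IsLowerParaboloid.of_isLocalMin_sub (hφ : IsLowerParaboloid φ x p b)
    (hmin : IsLocalMin (fun z => f z - φ z) x) : IsLowerParaboloid f x p b := by
  filter_upwards [hφ, (tendsto_const_add_nhds_zero x).eventually hmin] with h h₁ h₂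
  linarith

theorem IsUpperParaboloid.of_isLocalMax_sub (hφ : IsUpperParaboloid φ x p b)
    (hmax : IsLocalMax (fun z => f z - φ z) x) : IsUpperParaboloid f x p b := by
  filter_upwards [hφ, (tendsto_const_add_nhds_zero x).eventually hmax] with h h₁ h₂
  linarith

/-- The paraboloid with vertex value `0`, slope `p` and Hessian `b` at `x`: the test function
realizing the jet `(p, b)`. -/
def paraboloid (x p : E) (b : E →L[ℝ] E →L[ℝ] ℝ) (z : E) : ℝ :=
  ⟪p, z - x⟫ + b (z - x) (z - x) / 2

theorem contDiff_paraboloid {k : WithTop ℕ∞} (x p : E) (b : E →L[ℝ] E →L[ℝ] ℝ) :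
    ContDiff ℝ k (paraboloid x p b) := by
  have hsub : ContDiff ℝ k fun z : E => z - x := contDiff_id.sub contDiff_const
  exact (contDiff_const.inner ℝ hsub).add (((b.contDiff.comp hsub).clm_apply hsub).div_const 2)

theorem fderiv_paraboloid (x p : E) (hb : IsSymmForm b) :
    fderiv ℝ (paraboloid x p b) = fun z => innerSL ℝ p + b (z - x) := by
  funext z
  have hsub : HasFDerivAt (fun z : E => z - x) (ContinuousLinearMap.id ℝ E) z :=
    (hasFDerivAt_id z).sub_const x
  have hlin : HasFDerivAt (fun z : E => ⟪p, z - x⟫) (innerSL ℝ p) z :=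
    (innerSL ℝ p).hasFDerivAt.comp z hsub
  have hquad := ((b.hasFDerivAt.comp z hsub).clm_apply hsub).mul_const (2⁻¹ : ℝ)
  refine ((hlin.add hquad).congr_fderiv ?_).fderiv
  ext k
  simp only [ContinuousLinearMap.comp_id, Function.comp_apply, add_apply, smul_apply,
    ContinuousLinearMap.flip_apply, hb k (z - x), smul_eq_mul]
  ring

theorem gradient_paraboloid [CompleteSpace E] (x p : E) (hb : IsSymmForm b) :
    gradient (paraboloid x p b) x = p := by
  simp only [gradient, fderiv_paraboloid x p hb, sub_self, map_zero, add_zero]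
  exact (InnerProductSpace.toDual ℝ E).symm_apply_apply p

theorem fderiv_fderiv_paraboloid (x p : E) (hb : IsSymmForm b) :
    fderiv ℝ (fderiv ℝ (paraboloid x p b)) x = b := by
  rw [fderiv_paraboloid x p hb]
  have hsub : HasFDerivAt (fun z : E => z - x) (ContinuousLinearMap.id ℝ E) x :=
    (hasFDerivAt_id x).sub_const x
  exact ((b.hasFDerivAt.comp x hsub).const_add _).fderiv

theorem IsLowerParaboloid.isLocalMin_sub (h : IsLowerParaboloid f x p b) :
    IsLocalMin (fun z => f z - paraboloid x p b z) x := by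
  rw [IsLocalMin, IsMinFilter, ← map_add_left_nhds_zero x, eventually_map]
  refine Eventually.mono h fun k hk => ?_
  simp only [paraboloid, sub_self, add_sub_cancel_left, inner_zero_right, map_zero]
  linarith

theorem IsUpperParaboloid.isLocalMax_sub (h : IsUpperParaboloid f x p b) :
    IsLocalMax (fun z => f z - paraboloid x p b z) x := by
  rw [IsLocalMax, IsMaxFilter, ← map_add_left_nhds_zero x, eventually_map]
  refine Eventually.mono h fun k hk => ?_
  simp only [paraboloid, sub_self, add_sub_cancel_left, inner_zero_right, map_zero]
  linarith

end Paraboloid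

variable {n : ℕ}

local notation "𝔼" => EuclideanSpace ℝ (Fin n)

variable {Ω : Set (EuclideanSpace ℝ (Fin n))}
  {f ψ : EuclideanSpace ℝ (Fin n) → ℝ → EuclideanSpace ℝ (Fin n) → ℝ}
  {u : EuclideanSpace ℝ (Fin n) → ℝ} {x x₀ p p₀ : EuclideanSpace ℝ (Fin n)}
  {b : EuclideanSpace ℝ (Fin n) →L[ℝ] EuclideanSpace ℝ (Fin n) →L[ℝ] ℝ}

theorem phase_hessian_paraboloid (x p : 𝔼) (hb : IsSymmForm b) :
    phase (hessian (paraboloid x p b) x) = formPhase b := by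
  rw [hessian, fderiv_fderiv_paraboloid x p hb, formPhase]

theorem IsViscositySolution.formPhase_le (hu : IsViscositySolution Ω f u) (hx : x ∈ Ω)
    (hb : IsSymmForm b) (h : IsLowerParaboloid u x p b) : formPhase b ≤ f x (u x) p := by
  simpa only [phase_hessian_paraboloid x p hb, gradient_paraboloid x p hb] using
    hu.supersolution x hx _ (contDiff_paraboloid x p b).contDiffAt (h.isLocalMin_sub.on Ω)

theorem IsViscositySolution.le_formPhase (hu : IsViscositySolution Ω f u) (hx : x ∈ Ω)
    (hb : IsSymmForm b) (h : IsUpperParaboloid u x p b) : f x (u x) p ≤ formPhase b := by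
  simpa only [phase_hessian_paraboloid x p hb, gradient_paraboloid x p hb] using
    hu.subsolution x hx _ (contDiff_paraboloid x p b).contDiffAt (h.isLocalMax_sub.on Ω)

theorem IsViscositySolution.le_formPhase_of_hasSecondOrderExpansion
    (hu : IsViscositySolution Ω f u) (hx : x ∈ Ω) (h : HasSecondOrderExpansion u x p b) :
    f x (u x) p ≤ formPhase b := by
  refine le_formPhase_of_eventually_add h.symm ?_
  filter_upwards [self_mem_nhdsWithin] with ε hε
  exact hu.le_formPhase hx (h.symm.add (isSymmForm_innerForm.smul ε)) (h.upper ε hε)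

theorem isViscositySolution_of_paraboloids (hΩ : IsOpen Ω) (hu : ContinuousOn u Ω)
    (hsub : ∀ x ∈ Ω, ∀ p b, IsSymmForm b → IsUpperParaboloid u x p b →
      f x (u x) p ≤ formPhase b)
    (hsuper : ∀ x ∈ Ω, ∀ p b, IsSymmForm b → IsLowerParaboloid u x p b →
      formPhase b ≤ f x (u x) p) :
    IsViscositySolution Ω f u where
  continuousOn := hu
  subsolution x hx φ hφ hmax := by
    have hexp := hasSecondOrderExpansion_of_contDiffAt hφ
    refine le_formPhase_of_eventually_add hexp.symm ?_
    filter_upwards [self_mem_nhdsWithin] with ε hε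
    exact hsub x hx _ _ (hexp.symm.add (isSymmForm_innerForm.smul ε))
      ((hexp.upper ε hε).of_isLocalMax_sub (hmax.isLocalMax (hΩ.mem_nhds hx)))
  supersolution x hx φ hφ hmin := by
    have hexp := hasSecondOrderExpansion_of_contDiffAt hφ
    refine formPhase_le_of_eventually_sub hexp.symm ?_
    filter_upwards [self_mem_nhdsWithin] with ε hε
    exact hsuper x hx _ _ (hexp.symm.sub (isSymmForm_innerForm.smul ε))
      ((hexp.lower ε hε).of_isLocalMin_sub (hmin.isLocalMin (hΩ.mem_nhds hx)))

theorem exists_eventually_norm_subdifferential_le (hΩ : IsOpen Ω) (hu : ContinuousOn u Ω)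
    (hx₀ : x₀ ∈ Ω) : ∃ M, ∀ᶠ x in 𝓝 x₀, ∀ p ∈ subdifferential Ω u x, ‖p‖ ≤ M := by
  obtain ⟨R, hR, hball⟩ := nhds_basis_closedBall.mem_iff.mp (hΩ.mem_nhds hx₀)
  obtain ⟨C, hC⟩ := (isCompact_closedBall x₀ R).exists_bound_of_continuousOn (hu.mono hball)
  refine ⟨2 * C / (R / 2), ?_⟩
  filter_upwards [closedBall_mem_nhds x₀ (half_pos hR)] with x hx p hp
  have hxR : x ∈ closedBall x₀ R := closedBall_subset_closedBall (by linarith) hx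
  have hC₀ : 0 ≤ C := (norm_nonneg _).trans (hC x hxR)
  rcases (norm_nonneg p).eq_or_lt with h₀ | h₀
  · rw [← h₀]
    positivity
  have hz : x + (R / 2 / ‖p‖) • p ∈ closedBall x₀ R := by
    have hstep : dist (x + (R / 2 / ‖p‖) • p) x = R / 2 := by
      rw [dist_self_add_left, norm_smul, Real.norm_of_nonneg (by positivity),
        div_mul_cancel₀ _ h₀.ne']
    rw [mem_closedBall] at hx ⊢
    linarith [dist_triangle (x + (R / 2 / ‖p‖) • p) x x₀]
  have hslope : R / 2 * ‖p‖ ≤ u (x + (R / 2 / ‖p‖) • p) - u x := by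
    have h := hp _ (hball hz)
    rw [add_sub_cancel_left, real_inner_smul_right, real_inner_self_eq_norm_sq,
      div_mul_eq_mul_div, pow_two, ← mul_assoc, mul_div_cancel_right₀ _ h₀.ne'] at h
    linarith
  rw [le_div_iff₀ (by positivity)]
  linarith [(abs_le.mp (hC x hxR)).1, (abs_le.mp (hC _ hz)).2]

theorem eventually_le_rhs_of_contDiffOn (hΩ : IsOpen Ω) (hu : ContDiffOn ℝ 1 u Ω)
    (hψ : ContinuousAt (fun q : 𝔼 × ℝ × 𝔼 => ψ q.1 q.2.1 q.2.2) (x₀, u x₀, p₀)) (hx₀ : x₀ ∈ Ω)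
    (hp₀ : p₀ ∈ subdifferential Ω u x₀) {ε : ℝ} (hε : 0 < ε) :
    ∀ᶠ x in 𝓝 x₀, ∀ p ∈ subdifferential Ω u x, ψ x₀ (u x₀) p₀ - ε ≤ ψ x (u x) p := by
  have hC1 (x) (hx : x ∈ Ω) : ContDiffAt ℝ 1 u x := hu.contDiffAt (hΩ.mem_nhds hx)
  have hgrad (x) (hx : x ∈ Ω) (p) (hp : p ∈ subdifferential Ω u x) : p = gradient u x :=
    (isLowerParaboloid_zero_of_mem_subdifferential (hΩ.mem_nhds hx) hp).eq_of_hasGradientAt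
      ((hC1 x hx).differentiableAt one_ne_zero).hasGradientAt
  have hcont : ContinuousAt (gradient u) x₀ :=
    (InnerProductSpace.toDual ℝ 𝔼).symm.continuous.continuousAt.comp
      ((hC1 x₀ hx₀).fderiv_right (m := 0) (zero_add 1).le).continuousAt
  rw [hgrad x₀ hx₀ p₀ hp₀] at hψ ⊢
  have hlim : Tendsto (fun x => ψ x (u x) (gradient u x)) (𝓝 x₀)
      (𝓝 (ψ x₀ (u x₀) (gradient u x₀))) :=
    hψ.tendsto.comp (tendsto_id.prodMk_nhds
      ((hC1 x₀ hx₀).continuousAt.tendsto.prodMk_nhds hcont))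
  filter_upwards [hlim.eventually (lt_mem_nhds (sub_lt_self _ hε)), hΩ.mem_nhds hx₀]
    with x hx hxΩ p hp
  rw [hgrad x hxΩ p hp]
  exact hx.le

theorem exists_eventually_affine_le_rhs_of_convexOn (hΩ : IsOpen Ω) (hu : ContinuousOn u Ω)
    (hψ : ∀ p, ContinuousAt (fun q : 𝔼 × ℝ × 𝔼 => ψ q.1 q.2.1 q.2.2) (x₀, u x₀, p))
    (hconv : ConvexOn ℝ univ (ψ x₀ (u x₀))) (hx₀ : x₀ ∈ Ω) (p₀ : 𝔼) {ε : ℝ} (hε : 0 < ε) :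
    ∃ ξ : 𝔼, ∀ᶠ x in 𝓝 x₀, ∀ p ∈ subdifferential Ω u x,
      ψ x₀ (u x₀) p₀ - ε + ⟪ξ, p - p₀⟫ ≤ ψ x (u x) p := by
  obtain ⟨ξ, hξ⟩ := exists_mem_subdifferential isOpen_univ hconv (mem_univ p₀)
  obtain ⟨M, hM⟩ := exists_eventually_norm_subdifferential_le hΩ hu hx₀
  have hucont : ContinuousAt u x₀ := hu.continuousAt (hΩ.mem_nhds hx₀)
  have htube : ∀ᶠ x in 𝓝 x₀, ∀ p ∈ closedBall (0 : 𝔼) M,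
      ψ x₀ (u x₀) p - ε < ψ x (u x) p := by
    refine (isCompact_closedBall (0 : 𝔼) M).eventually_forall_of_forall_eventually fun p _ => ?_
    have hlim : Tendsto (fun z : 𝔼 × 𝔼 => (z.1, u z.1, z.2)) (𝓝 (x₀, p)) (𝓝 (x₀, u x₀, p)) :=
      continuousAt_fst.tendsto.prodMk_nhds
        ((hucont.tendsto.comp continuousAt_fst.tendsto).prodMk_nhds continuousAt_snd.tendsto)
    have hlim₀ : Tendsto (fun z : 𝔼 × 𝔼 => (x₀, u x₀, z.2)) (𝓝 (x₀, p)) (𝓝 (x₀, u x₀, p)) :=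
      tendsto_const_nhds.prodMk_nhds (tendsto_const_nhds.prodMk_nhds continuousAt_snd.tendsto)
    exact (((hψ p).tendsto.comp hlim₀).sub_const ε).eventually_lt ((hψ p).tendsto.comp hlim)
      (sub_lt_self _ hε)
  refine ⟨ξ, ?_⟩
  filter_upwards [hM, htube] with x hxM hx p hp
  linarith [hx p (mem_closedBall_zero_iff.mpr (hxM p hp)), hξ p (mem_univ p)]

theorem exists_eventually_affine_le_rhs (hΩ : IsOpen Ω) (hu : ContinuousOn u Ω)
    (hψ : ContinuousOn (fun q : 𝔼 × ℝ × 𝔼 => ψ q.1 q.2.1 q.2.2) (Ω ×ˢ univ))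
    (hcase : ContDiffOn ℝ 1 u Ω ∨ ∀ x ∈ Ω, ∀ r, ConvexOn ℝ univ (ψ x r)) (hx₀ : x₀ ∈ Ω)
    (hp₀ : p₀ ∈ subdifferential Ω u x₀) {ε : ℝ} (hε : 0 < ε) :
    ∃ ξ : 𝔼, ∀ᶠ x in 𝓝 x₀, ∀ p ∈ subdifferential Ω u x,
      ψ x₀ (u x₀) p₀ - ε + ⟪ξ, p - p₀⟫ ≤ ψ x (u x) p := by
  have hψat (p : 𝔼) : ContinuousAt (fun q : 𝔼 × ℝ × 𝔼 => ψ q.1 q.2.1 q.2.2) (x₀, u x₀, p) :=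
    hψ.continuousAt ((hΩ.prod isOpen_univ).mem_nhds ⟨hx₀, mem_univ _⟩)
  rcases hcase with hC1 | hconv
  · refine ⟨0, ?_⟩
    simpa only [inner_zero_left, add_zero] using
      eventually_le_rhs_of_contDiffOn hΩ hC1 (hψat p₀) hx₀ hp₀ hε
  · exact exists_eventually_affine_le_rhs_of_convexOn hΩ hu hψat (hconv x₀ hx₀ _) hx₀ p₀ hε

theorem IsViscositySolution.isAESubsolution (hu : IsViscositySolution Ω ψ u) (hΩ : IsOpen Ω)
    (hconv : ConvexOn ℝ Ω u) {U : Set 𝔼} (hU : U ⊆ Ω) {L : ℝ} {ξ : 𝔼}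
    (hle : ∀ x ∈ U, ∀ p ∈ subdifferential Ω u x, L + ⟪ξ, p⟫ ≤ ψ x (u x) p) :
    IsAESubsolution U L ξ u := by
  filter_upwards [ae_exists_hasSecondOrderExpansion hconv hΩ] with x hx hxU
  obtain ⟨p, hp, b, hexp⟩ := hx (hU hxU)
  exact ⟨p, fun z hz => hp z (hU hz), b, hexp,
    (hle x hxU p hp).trans (hu.le_formPhase_of_hasSecondOrderExpansion (hU hxU) hexp)⟩

end Viscosity

section Rotation

variable {n : ℕ}

local notation "𝔼" => EuclideanSpace ℝ (Fin n)
local notation "𝔠" => Real.cos (Real.pi / 4)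
local notation "𝔰" => Real.sin (Real.pi / 4)

variable {Ω K : Set (EuclideanSpace ℝ (Fin n))} {u v : EuclideanSpace ℝ (Fin n) → ℝ}
  {x y p q x₀ y₀ : EuclideanSpace ℝ (Fin n)}
  {a b : EuclideanSpace ℝ (Fin n) →L[ℝ] EuclideanSpace ℝ (Fin n) →L[ℝ] ℝ}
  {ψ : EuclideanSpace ℝ (Fin n) → ℝ → EuclideanSpace ℝ (Fin n) → ℝ}

theorem cos_pi_div_four_pos : 0 < 𝔠 := by
  rw [Real.cos_pi_div_four]
  positivity

theorem sin_pi_div_four_pos : 0 < 𝔰 := by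
  rw [Real.sin_pi_div_four]
  positivity

/-- The slope `Du(x)` of the original graph over the base point `x`, recovered from the position
`y = s Du(x) + c x` of the corresponding point of the rotated graph. -/
def preGradient (x y : 𝔼) : 𝔼 := 𝔰⁻¹ • (y - 𝔠 • x)

theorem preGradient_basePoint (y p : 𝔼) : preGradient (basePoint y p) y = 𝔰 • y + 𝔠 • p := by
  rw [preGradient, inv_smul_eq_iff₀ sin_pi_div_four_pos.ne', basePoint]
  ext i
  simp only [PiLp.sub_apply, PiLp.add_apply, PiLp.smul_apply, smul_eq_mul]
  linear_combination -y i * Real.sin_sq_add_cos_sq (Real.pi / 4)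

theorem rotatedPhase_eq (ψ : 𝔼 → ℝ → 𝔼 → ℝ) (u : 𝔼 → ℝ) (y : 𝔼) (r : ℝ) (p : 𝔼) :
    rotatedPhase ψ u y r p = ψ (basePoint y p) (u (basePoint y p))
      (preGradient (basePoint y p) y) - n * Real.pi / 4 := by
  rw [rotatedPhase, preGradient_basePoint]

theorem strongConvexOn_auxPotential (hu : ConvexOn ℝ Ω u) :
    StrongConvexOn Ω 𝔠 (auxPotential u) :=
  strongConvexOn_mul_add_sq hu sin_pi_div_four_pos.le _

theorem continuousOn_auxPotential (hu : ContinuousOn u Ω) : ContinuousOn (auxPotential u) Ω :=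
  (hu.const_mul _).add (by fun_prop)

theorem abs_auxPotential_sub_le (u v : 𝔼 → ℝ) (x : 𝔼) :
    |auxPotential v x - auxPotential u x| ≤ |v x - u x| := by
  rw [auxPotential, auxPotential, add_sub_add_right_eq_sub, ← mul_sub, abs_mul]
  exact mul_le_of_le_one_left (abs_nonneg _) (Real.abs_sin_le_one _)

theorem isOpen_rotatedDomain (hu : ConvexOn ℝ Ω u) (hΩ : IsOpen Ω) :
    IsOpen (rotatedDomain Ω u) :=
  isOpen_subgradientImage (strongConvexOn_auxPotential hu) cos_pi_div_four_pos hΩ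

theorem hasGradientAt_rotatedPotential (hu : ConvexOn ℝ Ω u) (hΩ : IsOpen Ω) (hx : x ∈ Ω)
    (hy : y ∈ subdifferential Ω (auxPotential u) x) :
    HasGradientAt (rotatedPotential Ω u) (𝔰⁻¹ • (𝔠 • y - x)) y := by
  have hleg : HasFDerivAt (legendre Ω (auxPotential u)) (innerSL ℝ x) y :=
    (hasGradientAt_legendre (strongConvexOn_auxPotential hu) cos_pi_div_four_pos hΩ hx
      hy).hasFDerivAt
  refine (((hasStrictFDerivAt_norm_sq y).hasFDerivAt.const_mul (𝔠 / (2 * 𝔰))).sub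
    (hleg.const_mul (1 / 𝔰))).congr_fderiv ?_
  ext k
  have hs := sin_pi_div_four_pos.ne'
  simp only [sub_apply, smul_apply, innerSL_apply_apply, smul_eq_mul, nsmul_eq_mul,
    InnerProductSpace.toDual_apply_apply, real_inner_smul_left, inner_sub_left, Nat.cast_ofNat]
  field_simp

theorem basePoint_inv_sin_smul (x y : 𝔼) : basePoint y (𝔰⁻¹ • (𝔠 • y - x)) = x := by
  rw [basePoint, smul_inv_smul₀ sin_pi_div_four_pos.ne', sub_sub_cancel]

theorem legendre_auxPotential_eq (Ω : Set 𝔼) (u : 𝔼 → ℝ) :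
    legendre Ω (auxPotential u) = fun y => -𝔰 * rotatedPotential Ω u y + 𝔠 / 2 * ‖y‖ ^ 2 := by
  have hs := sin_pi_div_four_pos.ne'
  funext y
  rw [rotatedPotential]
  field_simp
  ring

theorem neg_sin_smul_add_cos_smul (y p : 𝔼) (b : 𝔼 →L[ℝ] 𝔼 →L[ℝ] ℝ) :
    -𝔰 • p + 𝔠 • y = basePoint y p ∧
      -𝔰 • b + 𝔠 • innerForm 𝔼 = 𝔠 • innerForm 𝔼 - 𝔰 • b := by
  refine ⟨by rw [basePoint, neg_smul, neg_add_eq_sub], ?_⟩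
  ext h k
  simp only [add_apply, sub_apply, smul_apply, smul_eq_mul]
  ring

theorem isUpperParaboloid_legendre_auxPotential
    (h : IsLowerParaboloid (rotatedPotential Ω u) y p b) :
    IsUpperParaboloid (legendre Ω (auxPotential u)) y (basePoint y p)
      (𝔠 • innerForm 𝔼 - 𝔰 • b) := by
  obtain ⟨hslope, hform⟩ := neg_sin_smul_add_cos_smul y p b
  rw [legendre_auxPotential_eq, ← hslope, ← hform]
  exact h.mul_add_sq_of_nonpos (neg_nonpos.mpr sin_pi_div_four_pos.le) _

theorem isLowerParaboloid_legendre_auxPotential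
    (h : IsUpperParaboloid (rotatedPotential Ω u) y p b) :
    IsLowerParaboloid (legendre Ω (auxPotential u)) y (basePoint y p)
      (𝔠 • innerForm 𝔼 - 𝔰 • b) := by
  obtain ⟨hslope, hform⟩ := neg_sin_smul_add_cos_smul y p b
  rw [legendre_auxPotential_eq, ← hslope, ← hform]
  exact h.mul_add_sq_of_nonpos (neg_nonpos.mpr sin_pi_div_four_pos.le) _

theorem isLowerParaboloid_of_auxPotential (h : IsLowerParaboloid (auxPotential u) x y b) :
    IsLowerParaboloid u x (preGradient x y) (𝔰⁻¹ • (b - 𝔠 • innerForm 𝔼)) := by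
  have hs := sin_pi_div_four_pos
  have hu : u = fun z => 𝔰⁻¹ * auxPotential u z + (-(𝔰⁻¹ * 𝔠)) / 2 * ‖z‖ ^ 2 := by
    funext z
    rw [auxPotential]
    field_simp
    ring
  have hslope : 𝔰⁻¹ • y + (-(𝔰⁻¹ * 𝔠)) • x = preGradient x y := by
    rw [preGradient, smul_sub, smul_smul, neg_smul, sub_eq_add_neg]
  have hform : 𝔰⁻¹ • b + (-(𝔰⁻¹ * 𝔠)) • innerForm 𝔼 = 𝔰⁻¹ • (b - 𝔠 • innerForm 𝔼) := by
    ext h k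
    simp only [add_apply, sub_apply, smul_apply, smul_eq_mul]
    ring
  rw [hu, ← hslope, ← hform]
  exact h.mul_add_sq (inv_nonneg.mpr hs.le) _

theorem inv_sin_smul_sub_sub (b : 𝔼 →L[ℝ] 𝔼 →L[ℝ] ℝ) :
    𝔰⁻¹ • (𝔠 • innerForm 𝔼 - (𝔠 • innerForm 𝔼 - 𝔰 • b)) = b := by
  have hs := sin_pi_div_four_pos.ne'
  ext h k
  simp only [sub_apply, smul_apply, smul_eq_mul]
  field_simp
  ring

theorem isSymmForm_cos_smul_innerForm_sub (hb : IsSymmForm b) :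
    IsSymmForm (𝔠 • innerForm 𝔼 - 𝔰 • b) :=
  (isSymmForm_innerForm.smul _).sub (hb.smul _)

theorem isSymmForm_inv_sin_smul (ha : IsSymmForm a) :
    IsSymmForm (𝔰⁻¹ • (𝔠 • innerForm 𝔼 - a)) :=
  ((isSymmForm_innerForm.smul _).sub ha).smul _

theorem exists_eq_diagForm_of_pos (ha : IsSymmForm a) (hpos : ∀ k, k ≠ 0 → 0 < a k k) :
    ∃ (e : OrthonormalBasis (Fin n) ℝ 𝔼) (d : Fin n → ℝ), (∀ i, 0 < d i) ∧ a = diagForm e d := by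
  obtain ⟨e, d, rfl⟩ := ha.exists_eq_diagForm
  exact ⟨e, d, fun i => diagForm_basis e d i ▸ hpos _ (e.toBasis.ne_zero i), rfl⟩

theorem formPhase_le_of_isUpperParaboloid_legendre (hu : IsViscositySolution Ω ψ u)
    (hΩ : IsOpen Ω) (hconv : ConvexOn ℝ Ω u) (hx : x ∈ Ω)
    (hy : y ∈ subdifferential Ω (auxPotential u) x) (ha : IsSymmForm a)
    (hpos : ∀ k, k ≠ 0 → 0 < a k k)
    (hup : IsUpperParaboloid (legendre Ω (auxPotential u)) y x a) :
    formPhase (𝔰⁻¹ • (𝔠 • innerForm 𝔼 - a)) ≤ ψ x (u x) (preGradient x y) - n * Real.pi / 4 := by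
  obtain ⟨e, d, hd, rfl⟩ := exists_eq_diagForm_of_pos ha hpos
  have hD : subgradientImage Ω (auxPotential u) ∈ 𝓝 y :=
    (isOpen_rotatedDomain hconv hΩ).mem_nhds (mem_subgradientImage.mpr ⟨x, hx, hy⟩)
  have hlow := isLowerParaboloid_of_auxPotential
    (isLowerParaboloid_of_legendre (hΩ.mem_nhds hx) hD hy e (fun i => (hd i).ne') hup)
  have hsuper := hu.formPhase_le hx
    (((isSymmForm_diagForm e d⁻¹).sub (isSymmForm_innerForm.smul _)).smul _) hlow
  linarith [formPhase_rotate e hd]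

theorem formPhase_le_rotatedPhase (hu : IsViscositySolution Ω ψ u) (hΩ : IsOpen Ω)
    (hconv : ConvexOn ℝ Ω u) (hy : y ∈ rotatedDomain Ω u) (hb : IsSymmForm b)
    (h : IsLowerParaboloid (rotatedPotential Ω u) y p b) (r : ℝ) :
    formPhase b ≤ rotatedPhase ψ u y r p := by
  obtain ⟨x, hx, hxy⟩ := mem_subgradientImage.mp hy
  have hup := isUpperParaboloid_legendre_auxPotential h
  obtain ⟨rfl, hnonneg⟩ := (isLowerParaboloid_zero_of_mem_subdifferential
    ((isOpen_rotatedDomain hconv hΩ).mem_nhds hy)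
    (mem_subdifferential_legendre hx hxy)).eq_and_le hup
  rw [rotatedPhase_eq]
  refine formPhase_le_of_eventually_sub hb ?_
  filter_upwards [self_mem_nhdsWithin] with ε (hε : 0 < ε)
  have hgap (k : 𝔼) : (𝔠 • innerForm 𝔼 - 𝔰 • (b - ε • innerForm 𝔼)) k k =
      (𝔠 • innerForm 𝔼 - 𝔰 • b) k k + 𝔰 * ε * ‖k‖ ^ 2 := by
    simp only [sub_apply, smul_apply, smul_eq_mul, innerForm_self]
    ring
  have hmul : 0 < 𝔰 * ε := mul_pos sin_pi_div_four_pos hε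
  rw [← inv_sin_smul_sub_sub (b - ε • innerForm 𝔼)]
  refine formPhase_le_of_isUpperParaboloid_legendre hu hΩ hconv hx hxy
    (isSymmForm_cos_smul_innerForm_sub (hb.sub (isSymmForm_innerForm.smul ε)))
    (fun k hk => ?_) (hup.mono fun k => ?_)
  · rw [hgap]
    exact add_pos_of_nonneg_of_pos (hnonneg k) (mul_pos hmul (pow_pos (norm_pos_iff.mpr hk) 2))
  · rw [hgap]
    exact le_add_of_nonneg_right (by positivity)

theorem formPhase_sub_le_of_isLowerParaboloid (hv : ConvexOn ℝ Ω v)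
    (hD : subgradientImage Ω (auxPotential v) ∈ 𝓝 y) (hx : x ∈ Ω)
    (hy : y ∈ subdifferential Ω (auxPotential v) x) (hb : IsSymmForm b)
    (hpos : ∀ k, k ≠ 0 → 0 < b k k) (hlow : IsLowerParaboloid (auxPotential v) x y b)
    (ha : IsSymmForm a) (h : IsLowerParaboloid (legendre Ω (auxPotential v)) y q a) :
    formPhase (𝔰⁻¹ • (b - 𝔠 • innerForm 𝔼)) - n * Real.pi / 4 ≤
      formPhase (𝔰⁻¹ • (𝔠 • innerForm 𝔼 - a)) := by
  obtain ⟨e, d, hd, rfl⟩ := exists_eq_diagForm_of_pos hb hpos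
  have hle := (h.eq_and_le (isUpperParaboloid_legendre (strongConvexOn_auxPotential hv)
    cos_pi_div_four_pos hD hx hy e hd hlow)).2
  have hrot := formPhase_rotate e (d := d⁻¹) fun i => inv_pos.mpr (hd i)
  rw [inv_inv] at hrot
  rw [← hrot]
  refine formPhase_mono (isSymmForm_inv_sin_smul (isSymmForm_diagForm e d⁻¹))
    (isSymmForm_inv_sin_smul ha) fun k => ?_
  exact mul_le_mul_of_nonneg_left (sub_le_sub_left (hle k) _)
    (inv_nonneg.mpr sin_pi_div_four_pos.le)

theorem preGradient_eq_of_hasSecondOrderExpansion (hΩ : Ω ∈ 𝓝 x)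
    (hy : y ∈ subdifferential Ω (auxPotential v) x) (hexp : HasSecondOrderExpansion v x p b) :
    preGradient x y = p := by
  have hslope := (isLowerParaboloid_zero_of_mem_subdifferential hΩ hy
    |>.eq_and_le_of_hasSecondOrderExpansion (hexp.mul_add_sq sin_pi_div_four_pos 𝔠)).1
  rw [preGradient, hslope, add_sub_cancel_right, inv_smul_smul₀ sin_pi_div_four_pos.ne']

theorem formPhase_sub_le_of_hasSecondOrderExpansion (hΩ : Ω ∈ 𝓝 x) (hv : ConvexOn ℝ Ω v)
    (hexp : HasSecondOrderExpansion v x p b)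
    (hD : subgradientImage Ω (auxPotential v) ∈ 𝓝 y)
    (hy : y ∈ subdifferential Ω (auxPotential v) x) (ha : IsSymmForm a)
    (h : IsLowerParaboloid (legendre Ω (auxPotential v)) y q a) :
    formPhase b - n * Real.pi / 4 ≤ formPhase (𝔰⁻¹ • (𝔠 • innerForm 𝔼 - a)) := by
  have hs := sin_pi_div_four_pos
  have hslope : 𝔰 • p + 𝔠 • x = y := by
    rw [← preGradient_eq_of_hasSecondOrderExpansion hΩ hy hexp, preGradient,
      smul_inv_smul₀ hs.ne', sub_add_cancel]
  rw [sub_le_iff_le_add]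
  refine formPhase_le_of_eventually_sub hexp.symm ?_
  filter_upwards [Ioo_mem_nhdsGT (div_pos cos_pi_div_four_pos hs)] with ε hε
  set b' := 𝔰 • (b - ε • innerForm 𝔼) + 𝔠 • innerForm 𝔼 with hb'
  have hpos (k : 𝔼) (hk : k ≠ 0) : 0 < b' k k := by
    have hk2 : 0 < (𝔠 - 𝔰 * ε) * ‖k‖ ^ 2 :=
      mul_pos (by linarith [(lt_div_iff₀' hs).mp hε.2]) (pow_pos (norm_pos_iff.mpr hk) 2)
    have hbk := mul_nonneg hs.le (nonneg_of_hasSecondOrderExpansion hΩ hv hexp k)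
    simp only [hb', add_apply, sub_apply, smul_apply, smul_eq_mul, innerForm_self]
    linarith
  have hlow : IsLowerParaboloid (auxPotential v) x y b' := by
    rw [← hslope]
    exact (hexp.lower ε hε.1).mul_add_sq hs.le 𝔠
  have hle := formPhase_sub_le_of_isLowerParaboloid hv hD (mem_of_mem_nhds hΩ) hy
    (((hexp.symm.sub (isSymmForm_innerForm.smul ε)).smul 𝔰).add (isSymmForm_innerForm.smul 𝔠))
    hpos hlow ha h
  have hcancel : 𝔰⁻¹ • (b' - 𝔠 • innerForm 𝔼) = b - ε • innerForm 𝔼 := by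
    ext h k
    simp only [hb', add_apply, sub_apply, smul_apply, smul_eq_mul]
    field_simp
    ring
  rw [hcancel] at hle
  linarith

theorem IsAESubsolution.exists_near_le_formPhase {L r κ ρ : ℝ} {ξ : 𝔼}
    (hae : IsAESubsolution (ball x₀ (3 * r)) L ξ u) (hconv : ConvexOn ℝ Ω u)
    (hcont : ContinuousOn u Ω) (hr : 0 < r) (hball : closedBall x₀ (3 * r) ⊆ Ω)
    (hy₀ : y₀ ∈ subdifferential Ω (auxPotential u) x₀) (ha : IsSymmForm a) (hκ : 0 < κ)
    (htouch : IsLowerParaboloid (legendre Ω (auxPotential u)) y₀ x₀ (a + κ • innerForm 𝔼))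
    (hρ : 0 < ρ) :
    ∃ x₁ ∈ ball x₀ ρ, ∃ y₁ ∈ ball y₀ ρ,
      L + ⟪ξ, preGradient x₁ y₁⟫ - n * Real.pi / 4 ≤
        formPhase (𝔰⁻¹ • (𝔠 • innerForm 𝔼 - a)) := by
  have hrball : closedBall x₀ r ⊆ Ω :=
    (closedBall_subset_closedBall (by linarith)).trans hball
  obtain ⟨σ, hσ, hnear⟩ := exists_isLowerParaboloid_legendre_near
    (strongConvexOn_auxPotential hconv) cos_pi_div_four_pos (continuousOn_auxPotential hcont) hr
    hrball hy₀ ha hκ htouch (lt_min hρ hr)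
  obtain ⟨v, hv, hvconv, hvu⟩ := hae.exists_contDiff_approx
    (hconv.subset (ball_subset_closedBall.trans hball) (convex_ball _ _)) (hcont.mono hball) hr hσ
  have hvaux : ContinuousOn (auxPotential v) (closedBall x₀ r) :=
    continuousOn_auxPotential hv.continuous.continuousOn
  obtain ⟨x₁, ⟨hx₁ρ, hx₁r⟩, y₁, hy₁ρ, hy₁, q, hlow⟩ := hnear (auxPotential v) hvaux
    fun x hx => (abs_auxPotential_sub_le u v x).trans (hvu x hx).1
  refine ⟨x₁, ball_subset_ball (min_le_left ρ r) hx₁ρ, y₁,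
    ball_subset_ball (min_le_left ρ r) hy₁ρ, ?_⟩
  have hnhds : closedBall x₀ r ∈ 𝓝 x₁ := mem_of_superset
    (isOpen_ball.mem_nhds (ball_subset_ball (min_le_right ρ r) hx₁ρ)) ball_subset_closedBall
  have hD : subgradientImage (closedBall x₀ r) (auxPotential v) ∈ 𝓝 y₁ := by
    rw [subgradientImage_eq_univ (isCompact_closedBall _ _) ⟨x₁, hx₁r⟩ hvaux]
    exact univ_mem
  have hexp := hasSecondOrderExpansion_of_contDiffAt (hv.contDiffAt (x := x₁))
  rw [preGradient_eq_of_hasSecondOrderExpansion hnhds hy₁ hexp]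
  exact (sub_le_sub_right (hvu x₁ hx₁r).2 _).trans
    (formPhase_sub_le_of_hasSecondOrderExpansion hnhds hvconv hexp hD hy₁ ha hlow)

theorem IsAESubsolution.le_formPhase_of_isLowerParaboloid_legendre {L r κ : ℝ} {ξ : 𝔼}
    (hae : IsAESubsolution (ball x₀ (3 * r)) L ξ u) (hconv : ConvexOn ℝ Ω u)
    (hcont : ContinuousOn u Ω) (hr : 0 < r) (hball : closedBall x₀ (3 * r) ⊆ Ω)
    (hy₀ : y₀ ∈ subdifferential Ω (auxPotential u) x₀) (ha : IsSymmForm a) (hκ : 0 < κ)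
    (htouch : IsLowerParaboloid (legendre Ω (auxPotential u)) y₀ x₀ (a + κ • innerForm 𝔼)) :
    L + ⟪ξ, preGradient x₀ y₀⟫ - n * Real.pi / 4 ≤ formPhase (𝔰⁻¹ • (𝔠 • innerForm 𝔼 - a)) := by
  have hclosed : IsClosed {z : 𝔼 × 𝔼 | L + ⟪ξ, preGradient z.1 z.2⟫ - n * Real.pi / 4 ≤
      formPhase (𝔰⁻¹ • (𝔠 • innerForm 𝔼 - a))} :=
    isClosed_le (by unfold preGradient; fun_prop) continuous_const
  have hmem : (x₀, y₀) ∈ closure {z : 𝔼 × 𝔼 | L + ⟪ξ, preGradient z.1 z.2⟫ - n * Real.pi / 4 ≤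
      formPhase (𝔰⁻¹ • (𝔠 • innerForm 𝔼 - a))} := by
    refine Metric.mem_closure_iff.mpr fun ρ hρ => ?_
    obtain ⟨x₁, hx₁, y₁, hy₁, hle⟩ :=
      hae.exists_near_le_formPhase hconv hcont hr hball hy₀ ha hκ htouch hρ
    exact ⟨(x₁, y₁), hle, max_lt (mem_ball'.mp hx₁) (mem_ball'.mp hy₁)⟩
  rw [hclosed.closure_eq] at hmem
  exact hmem

theorem le_formPhase_of_isLowerParaboloid_legendre (hu : IsViscositySolution Ω ψ u)
    (hΩ : IsOpen Ω) (hconv : ConvexOn ℝ Ω u)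
    (hψ : ContinuousOn (fun q : 𝔼 × ℝ × 𝔼 => ψ q.1 q.2.1 q.2.2) (Ω ×ˢ univ))
    (hcase : ContDiffOn ℝ 1 u Ω ∨ ∀ x ∈ Ω, ∀ r, ConvexOn ℝ univ (ψ x r)) (hx : x ∈ Ω)
    (hy : y ∈ subdifferential Ω (auxPotential u) x) (ha : IsSymmForm a) {κ : ℝ} (hκ : 0 < κ)
    (hlow : IsLowerParaboloid (legendre Ω (auxPotential u)) y x (a + κ • innerForm 𝔼)) :
    ψ x (u x) (preGradient x y) - n * Real.pi / 4 ≤ formPhase (𝔰⁻¹ • (𝔠 • innerForm 𝔼 - a)) := by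
  refine le_of_forall_sub_le fun η hη => ?_
  have hp : preGradient x y ∈ subdifferential Ω u x :=
    mem_subdifferential_of_mul_add_sq hconv sin_pi_div_four_pos hx hy
  obtain ⟨ξ, hξ⟩ := exists_eventually_affine_le_rhs hΩ hu.continuousOn hψ hcase hx hp hη
  obtain ⟨R, hR, hball⟩ := Metric.nhds_basis_closedBall.eventually_iff.mp
    (hξ.and (hΩ.mem_nhds hx))
  obtain ⟨r, rfl⟩ : ∃ r, R = 3 * r := ⟨R / 3, by ring⟩
  have hae : IsAESubsolution (ball x (3 * r))
      (ψ x (u x) (preGradient x y) - η - ⟪ξ, preGradient x y⟫) ξ u := by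
    refine hu.isAESubsolution hΩ hconv (fun z hz => (hball (ball_subset_closedBall hz)).2)
      fun z hz q hq => ?_
    have hle := (hball (ball_subset_closedBall hz)).1 q hq
    rw [inner_sub_right] at hle
    linarith
  have hle := hae.le_formPhase_of_isLowerParaboloid_legendre hconv hu.continuousOn
    (by linarith) (fun z hz => (hball hz).2) hy ha hκ hlow
  linarith

theorem rotatedPhase_le_formPhase (hu : IsViscositySolution Ω ψ u) (hΩ : IsOpen Ω)
    (hconv : ConvexOn ℝ Ω u)
    (hψ : ContinuousOn (fun q : 𝔼 × ℝ × 𝔼 => ψ q.1 q.2.1 q.2.2) (Ω ×ˢ univ))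
    (hcase : ContDiffOn ℝ 1 u Ω ∨ ∀ x ∈ Ω, ∀ r, ConvexOn ℝ univ (ψ x r))
    (hy : y ∈ rotatedDomain Ω u) (hb : IsSymmForm b)
    (h : IsUpperParaboloid (rotatedPotential Ω u) y p b) (r : ℝ) :
    rotatedPhase ψ u y r p ≤ formPhase b := by
  obtain ⟨x, hx, hxy⟩ := mem_subgradientImage.mp hy
  have hlow := isLowerParaboloid_legendre_auxPotential h
  obtain rfl := hlow.eq_of_hasGradientAt (hasGradientAt_legendre
    (strongConvexOn_auxPotential hconv) cos_pi_div_four_pos hΩ hx hxy)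
  rw [rotatedPhase_eq]
  refine le_formPhase_of_eventually_add hb ?_
  filter_upwards [self_mem_nhdsWithin] with ε (hε : 0 < ε)
  have hform : 𝔠 • innerForm 𝔼 - 𝔰 • b =
      𝔠 • innerForm 𝔼 - 𝔰 • (b + ε • innerForm 𝔼) + (𝔰 * ε) • innerForm 𝔼 := by
    ext h k
    simp only [add_apply, sub_apply, smul_apply, smul_eq_mul]
    ring
  rw [hform] at hlow
  rw [← inv_sin_smul_sub_sub (b + ε • innerForm 𝔼)]
  exact le_formPhase_of_isLowerParaboloid_legendre hu hΩ hconv hψ hcase hx hxy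
    (isSymmForm_cos_smul_innerForm_sub (hb.add (isSymmForm_innerForm.smul ε)))
    (mul_pos sin_pi_div_four_pos hε) hlow

theorem proposition2p2_general (hΩ : IsOpen Ω)
    (hψ : ContinuousOn (fun q : 𝔼 × ℝ × 𝔼 => ψ q.1 q.2.1 q.2.2) (Ω ×ˢ univ))
    (hconv : ConvexOn ℝ Ω u) (hu : IsViscositySolution Ω ψ u)
    (hcase : ContDiffOn ℝ 1 u Ω ∨ ∀ x ∈ Ω, ∀ r, ConvexOn ℝ univ (ψ x r)) :
    IsOpen (rotatedDomain Ω u) ∧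
    (∀ y ∈ rotatedDomain Ω u, DifferentiableAt ℝ (rotatedPotential Ω u) y ∧
      basePoint y (gradient (rotatedPotential Ω u) y) ∈ Ω) ∧
    IsViscositySolution (rotatedDomain Ω u) (rotatedPhase ψ u) (rotatedPotential Ω u) := by
  have hopen := isOpen_rotatedDomain hconv hΩ
  have hdiff : ∀ y ∈ rotatedDomain Ω u, DifferentiableAt ℝ (rotatedPotential Ω u) y ∧
      basePoint y (gradient (rotatedPotential Ω u) y) ∈ Ω := by
    intro y hy
    obtain ⟨x, hx, hxy⟩ := mem_subgradientImage.mp hy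
    have hgrad := hasGradientAt_rotatedPotential hconv hΩ hx hxy
    rw [hgrad.gradient, basePoint_inv_sin_smul]
    exact ⟨hgrad.differentiableAt, hx⟩
  exact ⟨hopen, hdiff, isViscositySolution_of_paraboloids hopen
    (fun y hy => (hdiff y hy).1.continuousAt.continuousWithinAt)
    (fun y hy p b hb h => rotatedPhase_le_formPhase hu hΩ hconv hψ hcase hy hb h _)
    (fun y hy p b hb h => formPhase_le_rotatedPhase hu hΩ hconv hy hb h _)⟩

end Rotation

end

theorem proposition2p2 (n : ℕ)
    (ψ : EuclideanSpace ℝ (Fin n) → ℝ → EuclideanSpace ℝ (Fin n) → ℝ)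
    (hψ : ContinuousOn
      (fun q : EuclideanSpace ℝ (Fin n) × ℝ × EuclideanSpace ℝ (Fin n) => ψ q.1 q.2.1 q.2.2)
      (ball (0 : EuclideanSpace ℝ (Fin n)) 1 ×ˢ univ))
    (u : EuclideanSpace ℝ (Fin n) → ℝ)
    (hconv : ConvexOn ℝ (ball (0 : EuclideanSpace ℝ (Fin n)) 1) u)
    (hu : IsViscositySolution (ball (0 : EuclideanSpace ℝ (Fin n)) 1) ψ u)
    (hcase : ContDiffOn ℝ 1 u (ball (0 : EuclideanSpace ℝ (Fin n)) 1) ∨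
      ∀ x ∈ ball (0 : EuclideanSpace ℝ (Fin n)) 1, ∀ r : ℝ, ConvexOn ℝ univ (ψ x r)) :
    -- the rotated domain is open, and `ū`, `x(x̄) = c x̄ - s Dū(x̄)` are well defined on it
    IsOpen (rotatedDomain (ball (0 : EuclideanSpace ℝ (Fin n)) 1) u) ∧
    (∀ y ∈ rotatedDomain (ball (0 : EuclideanSpace ℝ (Fin n)) 1) u,
      DifferentiableAt ℝ (rotatedPotential (ball (0 : EuclideanSpace ℝ (Fin n)) 1) u) y ∧
      basePoint y (gradient (rotatedPotential (ball (0 : EuclideanSpace ℝ (Fin n)) 1) u) y)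
        ∈ ball (0 : EuclideanSpace ℝ (Fin n)) 1) ∧
    -- `ū` is a viscosity solution of the rotated equation there
    IsViscositySolution (rotatedDomain (ball (0 : EuclideanSpace ℝ (Fin n)) 1) u)
      (rotatedPhase ψ u)
      (rotatedPotential (ball (0 : EuclideanSpace ℝ (Fin n)) 1) u) :=
  proposition2p2_general isOpen_ball hψ hconv hu hcase
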